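/- Let $s,d\ge 1$ be integers. For $\vec\varphi=(\varphi_1,\dots,\varphi_{2s})\in\mathbb{Q}[x]^{2s}$, a function $\mathfrak a:\mathbb{Q}\to[0,\infty)$ and a finite set $A\subseteq\mathbb{Q}$, let $$M_{s,\mathfrak a,\vec\varphi}(A)=\sum \mathfrak a(a_1)\cdots\mathfrak a(a_{2s}),$$ where the sum is over all $(a_1,\dots,a_{2s})\in A^{2s}$ with $$\varphi_1(a_1)\cdots\varphi_s(a_s)=\varphi_{s+1}(a_{s+1})\cdots\varphi_{2s}(a_{2s}),$$ and let $J_{s,\mathfrak a,\vec\varphi}(A)$ be the same sum restricted to those $(a_1,\dots,a_{2s})$ that also satisfy $a_1\cdots a_s=a_{s+1}\cdots a_{2s}$. There is a constant $c=c(s,d)>0$, depending only on $s$ and $d$, such that the following holds. Let $K\ge 1$ be real, let $\vec\varphi\in\mathbb{Q}[x]^{2s}$ satisfy $1\le\deg\varphi_i\le d$ and $\varphi_i(0)\neq 0$ for each $1\le i\le 2s$, let $A\subseteq\mathbb{Q}$ be a finite set with $|A|\ge 2$ that contains neither $0$ nor a zero of any $\varphi_i$, and suppose that $|A\cdot A|=K|A|$,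 where $A\cdot A=\{ab: a,b\in A\}$. Let $\mathfrak a:\mathbb{Q}\to[0,\infty)$ be a function. Then $$\max\Big\{J_{s,\mathfrak a,\vec\varphi}(A),\ \frac{M_{s,\mathfrak a,\vec\varphi}(A)}{|A|}\Big\}\ \le\ c\,K^{Cs}\,(\log|A|)^{2s}\Big(\sum_{a\in A}\mathfrak a(a)^2\Big)^{s},$$ where $C=10+48\log(d+3)+6\log(2s)$ and all logarithms are to base $2$. -/

import Mathlib

open Polynomial
open scoped Pointwise

/-- The weighted count `M_{s,𝔞,φ}(A)` of the solutions in `A` of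
`φ_1(x_1) ⋯ φ_s(x_s) = φ_{s+1}(x_{s+1}) ⋯ φ_{2s}(x_{2s})`, where `(x_1, …, x_{2s})` has weight
`𝔞(x_1) ⋯ 𝔞(x_{2s})`. The indices `1, …, s` are `Fin.castAdd s i` and the indices
`s + 1, …, 2s` are `Fin.natAdd s i`, with `i : Fin s`. -/
noncomputable def weightedM (s : ℕ) (𝔞 : ℚ → ℝ) (φ : Fin (s + s) → ℚ[X]) (A : Finset ℚ) : ℝ :=
  ∑ a ∈ Fintype.piFinset (fun _ : Fin (s + s) => A),
    if (∏ i : Fin s, (φ (Fin.castAdd s i)).eval (a (Fin.castAdd s i))) =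
        ∏ i : Fin s, (φ (Fin.natAdd s i)).eval (a (Fin.natAdd s i))
    then ∏ i, 𝔞 (a i) else 0

/-- The weighted count `J_{s,𝔞,φ}(A)` of the solutions in `A` of the system
`x_1 ⋯ x_s = x_{s+1} ⋯ x_{2s}` and
`φ_1(x_1) ⋯ φ_s(x_s) = φ_{s+1}(x_{s+1}) ⋯ φ_{2s}(x_{2s})`, with the same weights. -/
noncomputable def weightedJ (s : ℕ) (𝔞 : ℚ → ℝ) (φ : Fin (s + s) → ℚ[X]) (A : Finset ℚ) : ℝ :=
  ∑ a ∈ Fintype.piFinset (fun _ : Fin (s + s) => A),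
    if (∏ i : Fin s, a (Fin.castAdd s i)) = (∏ i : Fin s, a (Fin.natAdd s i)) ∧
        (∏ i : Fin s, (φ (Fin.castAdd s i)).eval (a (Fin.castAdd s i))) =
          ∏ i : Fin s, (φ (Fin.natAdd s i)).eval (a (Fin.natAdd s i))
    then ∏ i, 𝔞 (a i) else 0

/-! The proof plays multiplicative growth against orthogonality, and binary trees of `p`-adic fibres
link the two.

A tree of depth `n` in `A` forces growth: `HasPadicTree.le_card_mul` gives `2 ^ n * |A| ≤ |A * A *
A|`, while Plünnecke–Ruzsa gives `|A * A * A| ≤ K ^ 3 * |A|`. Hence some `n` with `2 ^ n ≤ K ^ 3` is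
such that `A` has no tree of depth `n + 1`.

Without deep trees, character sums over `A` have small `2s`-norm
(`evenNorm_phaseSum_sq_le_of_not_hasPadicTree`). At a prime separating the set, at most one fibre
can carry a tree of the next smaller depth. That fibre costs a factor of exactly one, because no
solution has a single variable outside it. The other fibres have smaller depth and are recombined at
a cost depending only on `s` and `d`. For this, `φ(a)` is divided by its `p`-adically dominant
monomial, which leaves `1 + ε`. The two equations together equate two products of such factors, so a
unique `ε` of maximal norm is impossible (`exists_injOn_of_isColour`), and a square function
estimate follows.

Hölder reduces different `φ_i` to a single polynomial. `J` is the case `r = 1` of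
`weightedRatioCount`, and `M` is a sum of such counts over at most `K ^ (2 * s) * |A|` ratios. -/

/-- The elements of `B` with `p`-adic valuation `j`. -/
def padicFiber (p : ℕ) (j : ℤ) (B : Finset ℚ) : Finset ℚ := B.filter fun a => padicValRat p a = j

lemma mem_padicFiber {p : ℕ} {j : ℤ} {B : Finset ℚ} {a : ℚ} :
    a ∈ padicFiber p j B ↔ a ∈ B ∧ padicValRat p a = j := Finset.mem_filter

lemma padicFiber_subset (p : ℕ) (j : ℤ) (B : Finset ℚ) : padicFiber p j B ⊆ B :=
  Finset.filter_subset _ _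

/-- `B` contains a full binary tree of depth `n`, each of whose nodes splits a set into two
fibres of a `p`-adic valuation, where `p` may depend on the node. -/
def HasPadicTree : ℕ → Finset ℚ → Prop
  | 0, B => B.Nonempty
  | n + 1, B => ∃ p : ℕ, p.Prime ∧ ∃ i j : ℤ, i ≠ j ∧
      HasPadicTree n (padicFiber p i B) ∧ HasPadicTree n (padicFiber p j B)

lemma HasPadicTree.mono {n : ℕ} : ∀ {B B' : Finset ℚ}, B ⊆ B' → HasPadicTree n B →
    HasPadicTree n B' := by
  induction n with
  | zero => exact fun h hB => Finset.Nonempty.mono h hB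
  | succ n ih =>
    rintro B B' h ⟨p, hp, i, j, hij, h1, h2⟩
    exact ⟨p, hp, i, j, hij, ih (Finset.filter_subset_filter _ h) h1,
      ih (Finset.filter_subset_filter _ h) h2⟩

/-! ### Growth of product sets from trees -/

/-- Hall's condition for a set `J` follows by applying `H` at the element of `J` where `u` is least.
The resulting matching pairs each `u x` with its own larger value of `h`. -/
lemma sum_le_sum_of_level_sets {κ : Type*} [Fintype κ] (S : Finset ℤ) (u : κ → ℝ) (h : ℤ → ℝ)
    (hh : ∀ k, 0 ≤ h k)
    (H : ∀ x, (Finset.univ.filter fun y => u x ≤ u y).card ≤ (S.filter fun k => u x ≤ h k).card) :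
    ∑ x, u x ≤ ∑ k ∈ S, h k := by
  classical
  obtain ⟨f, hf, hft⟩ := (Finset.all_card_le_biUnion_card_iff_exists_injective
    (fun x : κ => S.filter fun k => u x ≤ h k)).1 (by
      intro J
      rcases J.eq_empty_or_nonempty with rfl | hJ
      · simp
      obtain ⟨x, hx, hmin⟩ := J.exists_min_image u hJ
      calc J.card ≤ (Finset.univ.filter fun y => u x ≤ u y).card :=
            Finset.card_le_card fun y hy => by simpa using hmin y hy
        _ ≤ (S.filter fun k => u x ≤ h k).card := H x
        _ ≤ _ := Finset.card_le_card (Finset.subset_biUnion_of_mem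
            (fun x : κ => S.filter fun k => u x ≤ h k) hx))
  have hft' : ∀ x, f x ∈ S ∧ u x ≤ h (f x) := fun x => Finset.mem_filter.1 (hft x)
  calc ∑ x, u x ≤ ∑ x, h (f x) := Finset.sum_le_sum fun x _ => (hft' x).2
    _ = ∑ k ∈ Finset.univ.image f, h k := (Finset.sum_image fun x _ y _ hxy => hf hxy).symm
    _ ≤ ∑ k ∈ S, h k := Finset.sum_le_sum_of_subset_of_nonneg
        (fun k hk => by
          obtain ⟨x, -, rfl⟩ := Finset.mem_image.1 hk
          exact (hft' x).1) fun k _ _ => hh k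

/-- Each use of Cauchy–Davenport in `ℤ` loses one, and the two-element summand gives one back. This
is where a tree node needs two distinct valuations. -/
lemma card_add_card_le_card_add_pair {S T : Finset ℤ} (hS : S.Nonempty) (hT : T.Nonempty)
    {α β : ℤ} (h : α ≠ β) : S.card + T.card ≤ (S + T + {α, β}).card := by
  have h1 := cauchy_davenport_add_of_linearOrder_isCancelAdd hS hT
  have h2 := cauchy_davenport_add_of_linearOrder_isCancelAdd (hS.add hT)
    (Finset.insert_nonempty α {β})
  rw [Finset.card_pair h] at h2
  have := hS.card_pos
  have := hT.card_pos
  have := (hS.add hT).card_pos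
  omega

lemma sum_card_padicFiber (p : ℕ) (B : Finset ℚ) :
    ∑ j ∈ B.image (padicValRat p), ((padicFiber p j B).card : ℝ) = B.card := by
  rw [Finset.card_eq_sum_card_image (padicValRat p) B]
  push_cast
  rfl

lemma exists_max_padicFiber (p : ℕ) {B : Finset ℚ} (hB : B.Nonempty) :
    ∃ m : ℝ, 0 < m ∧ (∃ i ∈ B.image (padicValRat p), ((padicFiber p i B).card : ℝ) = m) ∧
      ∀ i, ((padicFiber p i B).card : ℝ) ≤ m := by
  obtain ⟨i, hi, hmax⟩ := (B.image (padicValRat p)).exists_max_image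
    (fun i => ((padicFiber p i B).card : ℝ)) (hB.image _)
  refine ⟨_, ?_, ⟨i, hi, rfl⟩, fun j => ?_⟩
  · obtain ⟨a, ha, rfl⟩ := Finset.mem_image.1 hi
    exact_mod_cast Finset.card_pos.2 ⟨a, mem_padicFiber.2 ⟨ha, rfl⟩⟩
  · by_cases hj : j ∈ B.image (padicValRat p)
    · exact hmax j hj
    · have : padicFiber p j B = ∅ := by
        refine Finset.eq_empty_of_forall_notMem fun a ha => hj ?_
        rw [mem_padicFiber] at ha
        exact Finset.mem_image.2 ⟨a, ha⟩
      simp [this]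

/-- A binary tree of depth `n` inside `U` makes every product set `X * Y * U` large. -/
theorem HasPadicTree.le_card_mul {n : ℕ} : ∀ {U : Finset ℚ}, HasPadicTree n U → 0 ∉ U →
    ∀ X Y : Finset ℚ, X.Nonempty → Y.Nonempty → 0 ∉ X → 0 ∉ Y →
      2 ^ n * √((X.card : ℝ) * Y.card) ≤ ((X * Y * U).card : ℝ) := by
  induction n with
  | zero =>
    intro U hU hU0 X Y hX hY hX0 hY0
    obtain ⟨x, hx⟩ := hX
    obtain ⟨y, hy⟩ := hY
    obtain ⟨u, hu⟩ := hU
    have hx0 : x ≠ 0 := fun h => hX0 (h ▸ hx)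
    have hy0 : y ≠ 0 := fun h => hY0 (h ▸ hy)
    have hu0 : u ≠ 0 := fun h => hU0 (h ▸ hu)
    have h1 : X.card ≤ (X * Y * U).card := by
      refine Finset.card_le_card_of_injOn (fun a => a * y * u) (fun a ha =>
        Finset.mul_mem_mul (Finset.mul_mem_mul ha hy) hu) fun a _ b _ hab => ?_
      simpa [hy0, hu0] using hab
    have h2 : Y.card ≤ (X * Y * U).card := by
      refine Finset.card_le_card_of_injOn (fun a => x * a * u) (fun a ha =>
        Finset.mul_mem_mul (Finset.mul_mem_mul hx ha) hu) fun a _ b _ hab => ?_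
      simpa [hx0, hu0] using hab
    rw [pow_zero, one_mul]
    refine Real.sqrt_le_iff.2 ⟨by positivity, ?_⟩
    rw [sq]
    gcongr
  | succ n ih =>
    rintro U ⟨p, hp, α, β, hαβ, hα, hβ⟩ hU0 X Y hX hY hX0 hY0
    have : Fact p.Prime := ⟨hp⟩
    obtain ⟨mx, hmx, ⟨i₀, hi₀, hi₀m⟩, hmaxX⟩ := exists_max_padicFiber p hX
    obtain ⟨my, hmy, ⟨j₀, hj₀, hj₀m⟩, hmaxY⟩ := exists_max_padicFiber p hY
    set q : ℝ := 2 ^ n * √(mx * my) with hq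
    have hq0 : 0 < q := by positivity
    set IX := X.image (padicValRat p) with hIX
    set IY := Y.image (padicValRat p) with hIY
    let xf : ℤ → ℝ := fun i => ((padicFiber p i X).card : ℝ) / mx
    let yf : ℤ → ℝ := fun i => ((padicFiber p i Y).card : ℝ) / my
    let u : IX ⊕ IY → ℝ := Sum.elim (fun i => q * xf i) (fun j => q * yf j)
    let h : ℤ → ℝ := fun k => ((padicFiber p k (X * Y * U)).card : ℝ)
    have hprod : ∀ i j γ, HasPadicTree n (padicFiber p γ U) → (padicFiber p i X).Nonempty →
        (padicFiber p j Y).Nonempty →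
        2 ^ n * √(((padicFiber p i X).card : ℝ) * (padicFiber p j Y).card) ≤ h (i + j + γ) := by
      intro i j γ hγ hi hj
      refine (ih hγ (fun h0 => hU0 (padicFiber_subset _ _ _ h0)) _ _ hi hj
        (fun h0 => hX0 (padicFiber_subset _ _ _ h0))
        (fun h0 => hY0 (padicFiber_subset _ _ _ h0))).trans ?_
      refine Nat.cast_le.2 (Finset.card_le_card ?_)
      intro z hz
      obtain ⟨w, hw, c, hc, rfl⟩ := Finset.mem_mul.1 hz
      obtain ⟨a, ha, b, hb, rfl⟩ := Finset.mem_mul.1 hw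
      rw [mem_padicFiber] at ha hb hc ⊢
      have ha0 : a ≠ 0 := fun h => hX0 (h ▸ ha.1)
      have hb0 : b ≠ 0 := fun h => hY0 (h ▸ hb.1)
      have hc0 : c ≠ 0 := fun h => hU0 (h ▸ hc.1)
      refine ⟨Finset.mul_mem_mul (Finset.mul_mem_mul ha.1 hb.1) hc.1, ?_⟩
      rw [padicValRat.mul (mul_ne_zero ha0 hb0) hc0, padicValRat.mul ha0 hb0, ha.2, hb.2, hc.2]
    -- Fibre sizes are divided by their maxima, so both level sets at height `l ≤ 1` are nonempty.
    -- If fibres `i` and `j` reach height `l`, induction gives fibre `i + j + γ` of the product set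
    -- at least `q * l` elements, for `γ = α` and `γ = β`.
    have key : ∑ x, u x ≤ ∑ k ∈ (X * Y * U).image (padicValRat p), h k := by
      refine sum_le_sum_of_level_sets _ u h (fun k => Nat.cast_nonneg _) fun x => ?_
      obtain ⟨l, hl0, hl1, hul⟩ : ∃ l : ℝ, 0 < l ∧ l ≤ 1 ∧ u x = q * l := by
        rcases x with ⟨i, hi⟩ | ⟨j, hj⟩
        · refine ⟨xf i, ?_, (div_le_one hmx).2 (hmaxX i), rfl⟩
          obtain ⟨a, ha, rfl⟩ := Finset.mem_image.1 hi
          exact div_pos (by exact_mod_cast Finset.card_pos.2 ⟨a, mem_padicFiber.2 ⟨ha, rfl⟩⟩) hmx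
        · refine ⟨yf j, ?_, (div_le_one hmy).2 (hmaxY j), rfl⟩
          obtain ⟨a, ha, rfl⟩ := Finset.mem_image.1 hj
          exact div_pos (by exact_mod_cast Finset.card_pos.2 ⟨a, mem_padicFiber.2 ⟨ha, rfl⟩⟩) hmy
      rw [hul]
      set IXl := IX.filter fun i => l ≤ xf i with hIXl
      set IYl := IY.filter fun i => l ≤ yf i with hIYl
      have hXne : IXl.Nonempty := ⟨i₀, Finset.mem_filter.2 ⟨hi₀, by
        simp only [xf, hi₀m, div_self hmx.ne', hl1]⟩⟩
      have hYne : IYl.Nonempty := ⟨j₀, Finset.mem_filter.2 ⟨hj₀, by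
        simp only [yf, hj₀m, div_self hmy.ne', hl1]⟩⟩
      have hfilter : (Finset.univ.filter fun y => q * l ≤ u y).card ≤ IXl.card + IYl.card := by
        rw [← Finset.card_disjSum]
        refine Finset.card_le_card_of_injOn (Sum.map Subtype.val Subtype.val) ?_
          ((Sum.map_injective.2 ⟨Subtype.val_injective, Subtype.val_injective⟩).injOn)
        rintro (⟨i, hi⟩ | ⟨j, hj⟩) hy
        · have : q * l ≤ q * xf i := (Finset.mem_filter.1 (Finset.mem_coe.1 hy)).2
          simpa [hIXl, hi] using le_of_mul_le_mul_left this hq0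
        · have : q * l ≤ q * yf j := (Finset.mem_filter.1 (Finset.mem_coe.1 hy)).2
          simpa [hIYl, hj] using le_of_mul_le_mul_left this hq0
      refine hfilter.trans ((card_add_card_le_card_add_pair hXne hYne hαβ).trans
        (Finset.card_le_card fun z hz => ?_))
      obtain ⟨w, hw, γ, hγ, rfl⟩ := Finset.mem_add.1 hz
      obtain ⟨i, hi, j, hj, rfl⟩ := Finset.mem_add.1 hw
      have hγt : HasPadicTree n (padicFiber p γ U) := by
        rcases Finset.mem_insert.1 hγ with rfl | hγ
        · exact hα
        · rw [Finset.mem_singleton.1 hγ]; exact hβ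
      rw [hIXl, Finset.mem_filter] at hi
      rw [hIYl, Finset.mem_filter] at hj
      have hil : l * mx ≤ (padicFiber p i X).card := (le_div_iff₀ hmx).1 hi.2
      have hjl : l * my ≤ (padicFiber p j Y).card := (le_div_iff₀ hmy).1 hj.2
      have hine : (padicFiber p i X).Nonempty := by
        rw [← Finset.card_pos]
        exact_mod_cast (mul_pos hl0 hmx).trans_le hil
      have hjne : (padicFiber p j Y).Nonempty := by
        rw [← Finset.card_pos]
        exact_mod_cast (mul_pos hl0 hmy).trans_le hjl
      have hle : q * l ≤ h (i + j + γ) := by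
        refine le_trans ?_ (hprod i j γ hγt hine hjne)
        rw [hq, mul_assoc]
        gcongr
        rw [← Real.sqrt_sq hl0.le, ← Real.sqrt_mul (by positivity)]
        refine Real.sqrt_le_sqrt ?_
        calc mx * my * l ^ 2 = (l * mx) * (l * my) := by ring
          _ ≤ _ := by gcongr
      refine Finset.mem_filter.2 ⟨?_, hle⟩
      have hpos : 0 < h (i + j + γ) := (mul_pos hq0 hl0).trans_le hle
      have : (padicFiber p (i + j + γ) (X * Y * U)).Nonempty := by
        rw [← Finset.card_pos]
        exact (Nat.cast_pos (α := ℝ)).1 hpos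
      obtain ⟨a, ha⟩ := this
      exact Finset.mem_image.2 ⟨a, mem_padicFiber.1 ha⟩
    rw [sum_card_padicFiber] at key
    refine le_trans ?_ key
    have hsumX : ∑ i : IX, q * xf i = q * (X.card / mx) := by
      rw [Finset.sum_coe_sort IX (fun i => q * xf i), ← Finset.mul_sum, ← Finset.sum_div,
        sum_card_padicFiber]
    have hsumY : ∑ i : IY, q * yf i = q * (Y.card / my) := by
      rw [Finset.sum_coe_sort IY (fun i => q * yf i), ← Finset.mul_sum, ← Finset.sum_div,
        sum_card_padicFiber]
    rw [Fintype.sum_sum_type]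
    simp only [u, Sum.elim_inl, Sum.elim_inr]
    rw [hsumX, hsumY]
    set x : ℝ := X.card / mx with hx
    set y : ℝ := Y.card / my with hy
    have hx0 : 0 ≤ x := by positivity
    have hy0 : 0 ≤ y := by positivity
    have hXY : (X.card : ℝ) * Y.card = (mx * my) * (x * y) := by
      rw [hx, hy]; field_simp
    rw [hXY, Real.sqrt_mul (by positivity), Real.sqrt_mul hx0, hq]
    -- AM–GM on the two normalised sizes supplies the factor two gained at each level of the tree.
    have h3 := two_mul_le_add_sq (√x) (√y)
    rw [Real.sq_sqrt hx0, Real.sq_sqrt hy0] at h3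
    calc 2 ^ (n + 1) * (√(mx * my) * (√x * √y)) = 2 ^ n * √(mx * my) * (2 * √x * √y) := by ring
      _ ≤ 2 ^ n * √(mx * my) * (x + y) := by gcongr
      _ = _ := by ring

/-! ### Even norms and square function estimates -/

/-- Once the linear term in `y` is removed, the error is quadratic in `y`, so `x ^ 2` can keep the
coefficient one. For `x ≤ 2 * s * y` this is immediate. Otherwise put `t = y / x` and `z = 2 * s * t
< 1`, and compare `(1 + t) ^ (2s) ≤ exp z ≤ 1 + z + z ^ 2` with Bernoulli's inequality. -/
lemma add_pow_le_linear_add_pow {s : ℕ} (hs : 1 ≤ s) {x y : ℝ} (hx : 0 ≤ x) (hy : 0 ≤ y) :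
    (x + y) ^ (s + s) ≤ (s + s : ℕ) * x ^ (s + s - 1) * y + (x ^ 2 + 8 * s * y ^ 2) ^ s := by
  have hs1 : (1 : ℝ) ≤ s := by exact_mod_cast hs
  rcases le_or_gt x (2 * s * y) with h | h
  · have h1 : (x + y) ^ 2 ≤ x ^ 2 + 8 * s * y ^ 2 := by
      nlinarith [mul_le_mul_of_nonneg_right h hy, mul_nonneg (sub_nonneg.2 hs1) (sq_nonneg y)]
    calc (x + y) ^ (s + s) = ((x + y) ^ 2) ^ s := by rw [← pow_mul]; congr 1; ring
      _ ≤ (x ^ 2 + 8 * s * y ^ 2) ^ s := by gcongr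
      _ ≤ _ := le_add_of_nonneg_left (by positivity)
  · have hx0 : 0 < x := lt_of_le_of_lt (by positivity) h
    obtain ⟨t, rfl⟩ : ∃ t, y = x * t := ⟨y / x, by field_simp⟩
    have ht0 : 0 ≤ t := nonneg_of_mul_nonneg_right hy hx0
    have hst : 2 * s * t < 1 := by
      have : x * (2 * s * t) < x * 1 := by linarith
      exact lt_of_mul_lt_mul_left this hx0.le
    set z : ℝ := 2 * s * t with hz
    have hz0 : 0 ≤ z := by positivity
    have hexp : (1 + t) ^ (s + s) ≤ 1 + z + z ^ 2 := by
      calc (1 + t) ^ (s + s) ≤ (Real.exp t) ^ (s + s) := by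
            gcongr
            linarith [Real.add_one_le_exp t]
        _ = Real.exp z := by rw [← Real.exp_nat_mul]; congr 1; push_cast; rw [hz]; ring
        _ ≤ _ := by
          have := Real.abs_exp_sub_one_sub_id_le (x := z) (by rw [abs_of_nonneg hz0]; exact hst.le)
          linarith [(abs_le.1 this).2]
    have hber : 1 + s * (8 * s * t ^ 2) ≤ (1 + 8 * s * t ^ 2) ^ s :=
      one_add_mul_le_pow (le_trans (by norm_num) (by positivity : (0 : ℝ) ≤ 8 * s * t ^ 2)) s
    have hmain : (1 + t) ^ (s + s) ≤ z + (1 + 8 * s * t ^ 2) ^ s := by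
      have : z ^ 2 ≤ s * (8 * s * t ^ 2) := by rw [hz]; nlinarith [sq_nonneg ((s : ℝ) * t)]
      linarith
    have e1 : (x + x * t) ^ (s + s) = x ^ (s + s) * (1 + t) ^ (s + s) := by
      rw [← mul_pow]; congr 1; ring
    have e2 : (x ^ 2 + 8 * s * (x * t) ^ 2) ^ s = x ^ (s + s) * (1 + 8 * s * t ^ 2) ^ s := by
      rw [← two_mul, pow_mul, ← mul_pow]; congr 1; ring
    have e3 : ((s + s : ℕ) : ℝ) * x ^ (s + s - 1) * (x * t) = x ^ (s + s) * z := by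
      obtain ⟨m, hm⟩ : ∃ m, s + s = m + 1 := ⟨s + s - 1, by omega⟩
      have hm' : ((s + s : ℕ) : ℝ) = 2 * s := by push_cast; ring
      rw [hm', hm, Nat.add_sub_cancel, hz, pow_succ]
      ring
    rw [e1, e2, e3, ← mul_add]
    gcongr

/-- The `ℓ^{2s}` norm of a complex function on a finite type. -/
noncomputable def evenNorm {Ω : Type*} [Fintype Ω] (s : ℕ) (F : Ω → ℂ) : ℝ :=
  ‖WithLp.toLp ((s + s : ℕ) : ENNReal) F‖

section evenNorm

variable {Ω : Type*} [Fintype Ω] {s : ℕ}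

lemma fact_one_le_even (hs : 1 ≤ s) : Fact ((1 : ENNReal) ≤ ((s + s : ℕ) : ENNReal)) :=
  ⟨by exact_mod_cast (by omega : 1 ≤ s + s)⟩

lemma evenNorm_nonneg (hs : 1 ≤ s) (F : Ω → ℂ) : 0 ≤ evenNorm s F := by
  have := fact_one_le_even hs
  exact norm_nonneg _

lemma evenNorm_zero (hs : 1 ≤ s) : evenNorm s (0 : Ω → ℂ) = 0 := by
  have := fact_one_le_even hs
  simp [evenNorm]

lemma evenNorm_pow (hs : 1 ≤ s) (F : Ω → ℂ) :
    evenNorm s F ^ (s + s) = ∑ ω, ‖F ω‖ ^ (s + s) := by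
  have h0 : s + s ≠ 0 := by omega
  rw [evenNorm, PiLp.norm_eq_sum (by rw [ENNReal.toReal_natCast]; exact_mod_cast (by omega : 0 < s + s))]
  simp only [ENNReal.toReal_natCast, Real.rpow_natCast, one_div]
  exact Real.rpow_inv_natCast_pow (by positivity) h0

lemma evenNorm_sum_sq_le (hs : 1 ≤ s) {κ : Type*} (t : Finset κ) (F : κ → Ω → ℂ) :
    evenNorm s (fun ω => ∑ c ∈ t, F c ω) ^ 2 ≤ t.card * ∑ c ∈ t, evenNorm s (F c) ^ 2 := by
  have := fact_one_le_even hs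
  have h1 : evenNorm s (fun ω => ∑ c ∈ t, F c ω) ≤ ∑ c ∈ t, evenNorm s (F c) := by
    have h : WithLp.toLp ((s + s : ℕ) : ENNReal) (fun ω => ∑ c ∈ t, F c ω) =
        ∑ c ∈ t, WithLp.toLp ((s + s : ℕ) : ENNReal) (F c) := by
      ext ω
      simp
    rw [evenNorm, h]
    exact norm_sum_le _ _
  calc evenNorm s (fun ω => ∑ c ∈ t, F c ω) ^ 2 ≤ (∑ c ∈ t, evenNorm s (F c)) ^ 2 :=
        pow_le_pow_left₀ (evenNorm_nonneg hs _) h1 2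
    _ ≤ _ := sq_sum_le_card_mul_sum_sq

/-- Hölder's inequality for `2s` functions. -/
lemma sum_prod_norm_le_prod_evenNorm (hs : 1 ≤ s) (F : Fin (s + s) → Ω → ℂ) :
    ∑ ω, ∏ i, ‖F i ω‖ ≤ ∏ i, evenNorm s (F i) := by
  have hn0 : s + s ≠ 0 := by omega
  by_cases h : ∃ i, evenNorm s (F i) = 0
  · obtain ⟨i, hi⟩ := h
    have hz : ∀ ω, F i ω = 0 := by
      have h1 := evenNorm_pow hs (F i)
      rw [hi, zero_pow hn0, eq_comm, Finset.sum_eq_zero_iff_of_nonneg (fun _ _ => by positivity)] at h1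
      intro ω
      exact norm_eq_zero.1 ((pow_eq_zero_iff hn0).1 (h1 ω (Finset.mem_univ _)))
    rw [Finset.prod_eq_zero (Finset.mem_univ i) hi]
    exact (Finset.sum_eq_zero fun ω _ => Finset.prod_eq_zero (Finset.mem_univ i) (by simp [hz])).le
  · push Not at h
    have hpos : ∀ i, 0 < evenNorm s (F i) := fun i =>
      lt_of_le_of_ne (evenNorm_nonneg hs _) (h i).symm
    have hn : (0 : ℝ) < (s + s : ℕ) := by exact_mod_cast (by omega : 0 < s + s)
    have hpt : ∀ ω, ∏ i, (‖F i ω‖ / evenNorm s (F i)) ≤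
        ∑ i, ((s + s : ℕ) : ℝ)⁻¹ * (‖F i ω‖ / evenNorm s (F i)) ^ (s + s) := by
      intro ω
      have := Real.geom_mean_le_arith_mean_weighted (Finset.univ : Finset (Fin (s + s)))
        (fun _ => ((s + s : ℕ) : ℝ)⁻¹) (fun i => (‖F i ω‖ / evenNorm s (F i)) ^ (s + s))
        (fun _ _ => by positivity) (by simp only [Finset.sum_const, Finset.card_univ,
          Fintype.card_fin, nsmul_eq_mul]; exact mul_inv_cancel₀ hn.ne')
        (fun i _ => pow_nonneg (div_nonneg (norm_nonneg _) (hpos i).le) _)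
      refine le_trans (le_of_eq (Finset.prod_congr rfl fun i _ => ?_)) this
      exact (Real.pow_rpow_inv_natCast (div_nonneg (norm_nonneg _) (hpos i).le) hn0).symm
    have hsum : ∑ ω, ∏ i, (‖F i ω‖ / evenNorm s (F i)) ≤ 1 := by
      calc ∑ ω, ∏ i, (‖F i ω‖ / evenNorm s (F i))
          ≤ ∑ ω, ∑ i, ((s + s : ℕ) : ℝ)⁻¹ * (‖F i ω‖ / evenNorm s (F i)) ^ (s + s) :=
            Finset.sum_le_sum fun ω _ => hpt ω
        _ = ∑ i : Fin (s + s), ((s + s : ℕ) : ℝ)⁻¹ := by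
            rw [Finset.sum_comm]
            refine Finset.sum_congr rfl fun i _ => ?_
            simp only [div_pow]
            rw [← Finset.mul_sum, ← Finset.sum_div, ← evenNorm_pow hs,
              div_self (pow_ne_zero _ (h i)), mul_one]
        _ = 1 := by
            simp only [Finset.sum_const, Finset.card_univ,
              Fintype.card_fin, nsmul_eq_mul]; exact mul_inv_cancel₀ hn.ne'
    simp only [Finset.prod_div_distrib] at hsum
    rw [← Finset.sum_div, div_le_one (Finset.prod_pos fun i _ => hpos i)] at hsum
    exact hsum

end evenNorm

/-- The identity on the first `s` indices and complex conjugation on the last `s`. -/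
noncomputable def halfConj {s : ℕ} (i : Fin (s + s)) : ℂ →+* ℂ :=
  Fin.addCases (motive := fun _ => ℂ →+* ℂ) (fun _ => RingHom.id ℂ) (fun _ => starRingEnd ℂ) i

lemma halfConj_castAdd {s : ℕ} (i : Fin s) : halfConj (Fin.castAdd s i) = RingHom.id ℂ :=
  Fin.addCases_left i

lemma halfConj_natAdd {s : ℕ} (i : Fin s) : halfConj (Fin.natAdd s i) = starRingEnd ℂ :=
  Fin.addCases_right i

lemma norm_halfConj {s : ℕ} (i : Fin (s + s)) (z : ℂ) : ‖halfConj i z‖ = ‖z‖ := by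
  refine Fin.addCases (fun i => ?_) (fun i => ?_) i
  · rw [halfConj_castAdd]; rfl
  · rw [halfConj_natAdd]; exact RCLike.norm_conj z

lemma halfConj_ofReal {s : ℕ} (i : Fin (s + s)) (x : ℝ) : halfConj i (x : ℂ) = x := by
  refine Fin.addCases (fun i => ?_) (fun i => ?_) i
  · rw [halfConj_castAdd]; rfl
  · rw [halfConj_natAdd]; exact Complex.conj_ofReal x

lemma prod_halfConj {s : ℕ} (z : Fin (s + s) → ℂ) :
    ∏ i, halfConj i (z i) =
      (∏ i : Fin s, z (Fin.castAdd s i)) * ∏ i : Fin s, starRingEnd ℂ (z (Fin.natAdd s i)) := by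
  rw [Fin.prod_univ_add]
  simp only [halfConj_castAdd, halfConj_natAdd, RingHom.id_apply]

/-- The weighted exponential sum over `B` with phases `e`. -/
noncomputable def phaseSum {Ω α : Type*} (w : α → ℝ) (e : Ω → α → ℂ) (B : Finset α) (ω : Ω) : ℂ :=
  ∑ a ∈ B, (w a : ℂ) * e ω a

section phaseSum

variable {Ω α : Type*} {s : ℕ}

lemma prod_halfConj_phaseSum (w : α → ℝ) (e : Fin (s + s) → Ω → α → ℂ)
    (B : Fin (s + s) → Finset α) (ω : Ω) :
    ∏ i, halfConj i (phaseSum w (e i) (B i) ω) = ∑ a ∈ Fintype.piFinset B,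
      ((∏ i, w (a i) : ℝ) : ℂ) * ∏ i, halfConj i (e i ω (a i)) := by
  simp only [phaseSum, map_sum, map_mul, halfConj_ofReal]
  rw [Finset.prod_univ_sum]
  refine Finset.sum_congr rfl fun a _ => ?_
  rw [Finset.prod_mul_distrib]
  push_cast
  rfl

variable [Fintype Ω]

/-- If no solution has one variable in `B₂` and the others in `B₁`, then the norm of the sum over
`B₁ ∪ B₂` is controlled with constant one in front of the norm of the sum over `B₁`. -/
theorem evenNorm_phaseSum_union_sq_le [DecidableEq α] (hs : 1 ≤ s) (w : α → ℝ) (e : Ω → α → ℂ)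
    {B₁ B₂ : Finset α} (hd : Disjoint B₁ B₂)
    (H : ∀ (i₀ : Fin (s + s)) (a : Fin (s + s) → α), a i₀ ∈ B₂ → (∀ i, i ≠ i₀ → a i ∈ B₁) →
      ∑ ω, ∏ i, halfConj i (e ω (a i)) = 0) :
    evenNorm s (phaseSum w e (B₁ ∪ B₂)) ^ 2 ≤
      evenNorm s (phaseSum w e B₁) ^ 2 + 8 * s * evenNorm s (phaseSum w e B₂) ^ 2 := by
  set x := evenNorm s (phaseSum w e B₁) with hx
  set y := evenNorm s (phaseSum w e B₂) with hy
  have hx0 : 0 ≤ x := evenNorm_nonneg hs _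
  have hy0 : 0 ≤ y := evenNorm_nonneg hs _
  -- In the expansion of the `2s`-th power, `t` records the factors taken from `B₁`.
  let g : Finset (Fin (s + s)) → Fin (s + s) → Finset α := fun t i => if i ∈ t then B₁ else B₂
  let T : Finset (Fin (s + s)) → ℂ := fun t => ∑ ω, ∏ i, halfConj i (phaseSum w e (g t i) ω)
  have hexpand : ((evenNorm s (phaseSum w e (B₁ ∪ B₂)) ^ (s + s) : ℝ) : ℂ) = ∑ t, T t := by
    rw [evenNorm_pow hs]
    push_cast
    simp only [T]
    rw [Finset.sum_comm]
    refine Finset.sum_congr rfl fun ω _ => ?_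
    have h1 : ((‖phaseSum w e (B₁ ∪ B₂) ω‖ : ℂ)) ^ (s + s) =
        ∏ i : Fin (s + s), halfConj i (phaseSum w e (B₁ ∪ B₂) ω) := by
      rw [prod_halfConj]
      simp only [Finset.prod_const, Finset.card_univ, Fintype.card_fin]
      rw [← mul_pow, Complex.mul_conj, Complex.normSq_eq_norm_sq, ← two_mul, pow_mul]
      push_cast
      rfl
    have h2 : phaseSum w e (B₁ ∪ B₂) ω = phaseSum w e B₁ ω + phaseSum w e B₂ ω :=
      Finset.sum_union hd
    rw [h1, h2]
    simp only [map_add]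
    rw [Finset.prod_add]
    simp only [Finset.powerset_univ]
    refine Finset.sum_congr rfl fun t _ => ?_
    rw [← Finset.prod_mul_prod_compl t (fun i => halfConj i (phaseSum w e (g t i) ω)),
      Finset.compl_eq_univ_sdiff]
    congr 1
    · exact Finset.prod_congr rfl fun i hi => by simp [g, hi]
    · refine Finset.prod_congr rfl fun i hi => ?_
      have : i ∉ t := (Finset.mem_sdiff.1 hi).2
      simp [g, this]
  have hT : ∀ t, ‖T t‖ ≤ x ^ t.card * y ^ (s + s - t.card) := by
    intro t
    calc ‖T t‖ ≤ ∑ ω, ∏ i, ‖phaseSum w e (g t i) ω‖ := by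
          refine (norm_sum_le _ _).trans (Finset.sum_le_sum fun ω _ => ?_)
          rw [norm_prod]
          simp only [norm_halfConj]
          exact le_rfl
      _ ≤ ∏ i, evenNorm s (phaseSum w e (g t i)) := sum_prod_norm_le_prod_evenNorm hs _
      _ = _ := by
          have h1 : ∀ i, evenNorm s (phaseSum w e (g t i)) = if i ∈ t then x else y := by
            intro i
            by_cases hi : i ∈ t <;> simp [g, hi, hx, hy]
          simp only [h1]
          rw [Finset.prod_ite]
          simp only [Finset.prod_const]
          congr 2
          · simp
          · rw [Finset.filter_not, Finset.card_sdiff]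
            simp
  have hT0 : ∀ t : Finset (Fin (s + s)), tᶜ.card = 1 → T t = 0 := by
    intro t ht
    obtain ⟨i₀, hi₀⟩ := Finset.card_eq_one.1 ht
    simp only [T, prod_halfConj_phaseSum]
    rw [Finset.sum_comm]
    refine Finset.sum_eq_zero fun a ha => ?_
    rw [← Finset.mul_sum, H i₀ a, mul_zero]
    · have h1 := Fintype.mem_piFinset.1 ha i₀
      have : i₀ ∉ t := by rw [← Finset.mem_compl, hi₀]; simp
      simpa [g, this] using h1
    · intro i hi
      have h1 := Fintype.mem_piFinset.1 ha i
      have : i ∈ t := by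
        by_contra hc
        rw [← Finset.mem_compl, hi₀, Finset.mem_singleton] at hc
        exact hi hc
      simpa [g, this] using h1
  -- The `2s` terms with exactly one factor from `B₂` vanish by `H`, so the linear term can be
  -- subtracted from the binomial bound.
  have hbound : evenNorm s (phaseSum w e (B₁ ∪ B₂)) ^ (s + s) ≤
      (x + y) ^ (s + s) - (s + s : ℕ) * x ^ (s + s - 1) * y := by
    have hsplit : ∀ t : Finset (Fin (s + s)), ‖T t‖ ≤ x ^ t.card * y ^ (s + s - t.card) -
        if tᶜ.card = 1 then x ^ (s + s - 1) * y else 0 := by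
      intro t
      split_ifs with ht
      · have hc : t.card = s + s - 1 := by
          have := Finset.card_compl t
          have h2 := Finset.card_le_univ t
          rw [Fintype.card_fin] at this h2
          omega
        have : s + s - (s + s - 1) = 1 := by omega
        rw [hT0 t ht, hc, this]
        simp
      · simpa using hT t
    have hcount : ∑ t : Finset (Fin (s + s)),
        (if tᶜ.card = 1 then x ^ (s + s - 1) * y else 0) = (s + s : ℕ) * x ^ (s + s - 1) * y := by
      rw [← Equiv.sum_comp (Function.Involutive.toPerm compl compl_involutive)]
      simp only [Function.Involutive.coe_toPerm, compl_compl]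
      rw [← Finset.sum_filter, Finset.sum_const, nsmul_eq_mul, mul_assoc]
      congr 2
      have := Finset.card_powersetCard 1 (Finset.univ : Finset (Fin (s + s)))
      rwa [Finset.powersetCard_eq_filter, Finset.powerset_univ, Finset.card_univ,
        Fintype.card_fin, Nat.choose_one_right] at this
    calc evenNorm s (phaseSum w e (B₁ ∪ B₂)) ^ (s + s)
        = ‖((evenNorm s (phaseSum w e (B₁ ∪ B₂)) ^ (s + s) : ℝ) : ℂ)‖ := by
          rw [Complex.norm_real, Real.norm_of_nonneg (pow_nonneg (evenNorm_nonneg hs _) _)]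
      _ ≤ ∑ t, ‖T t‖ := by rw [hexpand]; exact norm_sum_le _ _
      _ ≤ _ := Finset.sum_le_sum fun t _ => hsplit t
      _ = _ := by rw [Finset.sum_sub_distrib, hcount, Fin.sum_pow_mul_eq_add_pow]
  have hfin : (evenNorm s (phaseSum w e (B₁ ∪ B₂)) ^ 2) ^ s ≤ (x ^ 2 + 8 * s * y ^ 2) ^ s := by
    rw [← pow_mul, two_mul]
    linarith [add_pow_le_linear_add_pow hs hx0 hy0]
  exact le_of_pow_le_pow_left₀ (by omega) (by positivity) hfin

/-- A square function estimate: if `f` separates the sets `B j` and no solution has a unique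
variable at which `f` is maximal, then the norm of the sum over all the `B j` is controlled. -/
theorem evenNorm_phaseSum_biUnion_sq_le [DecidableEq α] (hs : 1 ≤ s) (w : α → ℝ) (e : Ω → α → ℂ)
    (v : α → ℤ) (f : ℤ → ℚ) (R : Finset α) (J : Finset ℤ) (hf : Set.InjOn f J)
    (H : ∀ (i₀ : Fin (s + s)) (a : Fin (s + s) → α), (∀ i, a i ∈ R ∧ v (a i) ∈ J) →
      (∀ i, i ≠ i₀ → f (v (a i)) < f (v (a i₀))) → ∑ ω, ∏ i, halfConj i (e ω (a i)) = 0) :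
    evenNorm s (phaseSum w e (R.filter fun a => v a ∈ J)) ^ 2 ≤
      8 * s * ∑ j ∈ J, evenNorm s (phaseSum w e (R.filter fun a => v a = j)) ^ 2 := by
  -- Indices are inserted in increasing order of `f`, so a solution with one variable in the new
  -- fibre would have a unique maximum. The coefficient one on the earlier fibres keeps the bound
  -- independent of their number.
  have main : ∀ J' : Finset ℤ, J' ⊆ J →
      evenNorm s (phaseSum w e (R.filter fun a => v a ∈ J')) ^ 2 ≤
      8 * s * ∑ j ∈ J', evenNorm s (phaseSum w e (R.filter fun a => v a = j)) ^ 2 := by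
    intro J'
    induction J' using Finset.induction_on_max_value f with
    | empty =>
      intro _
      have : phaseSum w e (R.filter fun a => v a ∈ (∅ : Finset ℤ)) = 0 := by
        ext ω; simp [phaseSum]
      rw [this, evenNorm_zero hs]
      simp
    | insert j J' hj hmax ih =>
      intro hJ
      have hdis : Disjoint (R.filter fun a => v a ∈ J') (R.filter fun a => v a = j) := by
        rw [Finset.disjoint_left]
        intro a ha hb
        rw [Finset.mem_filter] at ha hb
        exact hj (hb.2 ▸ ha.2)
      have hun : (R.filter fun a => v a ∈ insert j J') =
          (R.filter fun a => v a ∈ J') ∪ R.filter fun a => v a = j := by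
        ext a
        simp only [Finset.mem_filter, Finset.mem_insert, Finset.mem_union]
        tauto
      rw [hun, Finset.sum_insert hj]
      have h1 := evenNorm_phaseSum_union_sq_le hs w e hdis (by
        intro i₀ a h0 hi
        rw [Finset.mem_filter] at h0
        have hi' : ∀ i, i ≠ i₀ → a i ∈ R ∧ v (a i) ∈ J' := fun i h =>
          Finset.mem_filter.1 (hi i h)
        refine H i₀ a (fun i => ?_) fun i h => ?_
        · rcases eq_or_ne i i₀ with rfl | h
          · exact ⟨h0.1, hJ (h0.2 ▸ Finset.mem_insert_self _ _)⟩
          · exact ⟨(hi' i h).1, hJ (Finset.mem_insert_of_mem (hi' i h).2)⟩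
        · rw [h0.2]
          refine lt_of_le_of_ne (hmax _ (hi' i h).2) fun heq => hj ?_
          have := hf (hJ (Finset.mem_insert_of_mem (hi' i h).2)) (hJ (Finset.mem_insert_self _ _)) heq
          exact this ▸ (hi' i h).2)
      have h2 := ih ((Finset.subset_insert _ _).trans hJ)
      linarith
  exact main J subset_rfl

end phaseSum

/-! ### Polynomial values under a `p`-adic norm -/

lemma padicNorm_prod_one_add_sub_one_lt {p : ℕ} [Fact p.Prime] {ι : Type*} (T : Finset ι)
    (ε : ι → ℚ) {ρ : ℚ} (hρ : 0 < ρ) (hρ1 : ρ ≤ 1) (h : ∀ i ∈ T, padicNorm p (ε i) < ρ) :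
    padicNorm p (∏ i ∈ T, (1 + ε i) - 1) < ρ := by
  classical
  induction T using Finset.induction_on with
  | empty => simpa using hρ
  | insert i T hi ih =>
    rw [Finset.prod_insert hi]
    have h1 := ih fun j hj => h j (Finset.mem_insert_of_mem hj)
    have h2 := h i (Finset.mem_insert_self _ _)
    set P := ∏ i ∈ T, (1 + ε i)
    have e : (1 + ε i) * P - 1 = (P - 1) + (ε i + ε i * (P - 1)) := by ring
    rw [e]
    refine lt_of_le_of_lt padicNorm.nonarchimedean (max_lt h1 ?_)
    refine lt_of_le_of_lt padicNorm.nonarchimedean (max_lt h2 ?_)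
    rw [padicNorm.mul]
    nlinarith [padicNorm.nonneg (p := p) (ε i), padicNorm.nonneg (p := p) (P - 1)]

/-- If exactly one of the `ε i` has maximal `p`-adic norm, and it occurs in the first product,
then the two products of the `1 + ε i` differ. -/
lemma prod_one_add_ne_of_unique_max {p : ℕ} [Fact p.Prime] {ι κ : Type*}
    (T : Finset ι) (T' : Finset κ) (ε : ι → ℚ) (ε' : κ → ℚ) (i₀ : ι) (hi₀ : i₀ ∈ T)
    (h0 : 0 < padicNorm p (ε i₀)) (h1 : padicNorm p (ε i₀) < 1)
    (hT : ∀ i ∈ T, i ≠ i₀ → padicNorm p (ε i) < padicNorm p (ε i₀))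
    (hT' : ∀ i ∈ T', padicNorm p (ε' i) < padicNorm p (ε i₀)) :
    ∏ i ∈ T, (1 + ε i) ≠ ∏ i ∈ T', (1 + ε' i) := by
  classical
  intro heq
  rw [← Finset.mul_prod_erase T _ hi₀] at heq
  have hP := padicNorm_prod_one_add_sub_one_lt (T.erase i₀) ε h0 h1.le
    fun i hi => hT i (Finset.mem_of_mem_erase hi) (Finset.ne_of_mem_erase hi)
  have hQ := padicNorm_prod_one_add_sub_one_lt T' ε' h0 h1.le hT'
  set P := ∏ i ∈ T.erase i₀, (1 + ε i)
  set Q := ∏ i ∈ T', (1 + ε' i)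
  -- Solved for `ε i₀`, the equation writes it as a combination of terms of strictly smaller norm.
  have e : ε i₀ = (Q - 1) - ((P - 1) + ε i₀ * (P - 1)) := by linear_combination heq
  have hlt : padicNorm p (ε i₀) < padicNorm p (ε i₀) := by
    conv_lhs => rw [e]
    refine lt_of_le_of_lt padicNorm.sub (max_lt hQ ?_)
    refine lt_of_le_of_lt padicNorm.nonarchimedean (max_lt hP ?_)
    rw [padicNorm.mul]
    nlinarith [padicNorm.nonneg (p := p) (P - 1)]
  exact lt_irrefl _ hlt

/-- `a` solves `a_1 ⋯ a_s = a_{s+1} ⋯ a_{2s}` and the same equation for the values of `φ`. -/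
def IsSolution {s : ℕ} (φ : ℚ[X]) (a : Fin (s + s) → ℚ) : Prop :=
  (∏ i : Fin s, a (Fin.castAdd s i)) = (∏ i : Fin s, a (Fin.natAdd s i)) ∧
    (∏ i : Fin s, φ.eval (a (Fin.castAdd s i))) = ∏ i : Fin s, φ.eval (a (Fin.natAdd s i))

/-- The first equation alone suffices: both sides have `s` factors, so `j` can be subtracted from
every valuation, and a single nonzero term remains. -/
lemma not_isSolution_of_valuation {s : ℕ} {p : ℕ} [Fact p.Prime] {φ : ℚ[X]}
    {a : Fin (s + s) → ℚ} (ha : ∀ i, a i ≠ 0) {j : ℤ} (i₀ : Fin (s + s))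
    (h0 : padicValRat p (a i₀) ≠ j) (h : ∀ i, i ≠ i₀ → padicValRat p (a i) = j) :
    ¬ IsSolution φ a := by
  have hval : ∀ T : Finset (Fin (s + s)),
      padicValRat p (∏ i ∈ T, a i) = ∑ i ∈ T, padicValRat p (a i) := by
    intro T
    induction T using Finset.induction_on with
    | empty => simp
    | insert i T hi ih =>
      rw [Finset.prod_insert hi, Finset.sum_insert hi,
        padicValRat.mul (ha i) (Finset.prod_ne_zero_iff.2 fun i _ => ha i), ih]
  have hval' : ∀ f : Fin s ↪ Fin (s + s),
      padicValRat p (∏ i : Fin s, a (f i)) = ∑ i : Fin s, padicValRat p (a (f i)) := fun f => by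
    have := hval (Finset.univ.map f)
    rwa [Finset.prod_map, Finset.sum_map] at this
  rintro ⟨hsol, -⟩
  have h1 := congrArg (padicValRat p) hsol
  have e1 := hval' (Fin.castAddEmb s)
  have e2 := hval' (Fin.natAddEmb s)
  simp only [Fin.castAddEmb_apply, Fin.natAddEmb_apply] at e1 e2
  rw [e1, e2] at h1
  have h2 : ∑ i : Fin s, (padicValRat p (a (Fin.castAdd s i)) - j) =
      ∑ i : Fin s, (padicValRat p (a (Fin.natAdd s i)) - j) := by
    rw [Finset.sum_sub_distrib, Finset.sum_sub_distrib, h1]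
  have hne : padicValRat p (a i₀) - j ≠ 0 := sub_ne_zero.2 h0
  have hz : ∀ i, i ≠ i₀ → padicValRat p (a i) - j = 0 := fun i hi => sub_eq_zero.2 (h i hi)
  induction i₀ using Fin.addCases with
  | left i₁ =>
    rw [Finset.sum_eq_single i₁ (fun i _ hi => hz _ fun hc => hi (Fin.castAdd_injective s s hc))
      (by simp), Finset.sum_eq_zero fun i _ => hz _ (by
        intro hc
        have := congrArg Fin.val hc
        simp only [Fin.val_natAdd, Fin.val_castAdd] at this
        omega)] at h2
    exact hne h2
  | right i₁ =>
    rw [Finset.sum_eq_zero fun i _ => hz _ (by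
        intro hc
        have := congrArg Fin.val hc
        simp only [Fin.val_natAdd, Fin.val_castAdd] at this
        omega), Finset.sum_eq_single i₁
      (fun i _ hi => hz _ fun hc => hi (Fin.natAdd_injective s s hc)) (by simp)] at h2
    exact hne h2.symm

lemma eq_of_pow_mul_pow_eq {u v : ℚ} (hu : 0 < u) (hv : 0 < v) {k l : ℕ} (hkl : k ≠ l)
    (h : u ^ k * v ^ l = v ^ k * u ^ l) : u = v := by
  by_contra hne
  have h1 : (u / v) ^ k = (u / v) ^ l := by
    rw [div_pow, div_pow, div_eq_div_iff (by positivity) (by positivity), h, mul_comm]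
  refine hkl (pow_right_injective₀ (div_pos hu hv) (fun h => hne ?_) h1)
  rwa [div_eq_one_iff_eq hv.ne'] at h

/-- Among the monomials of `φ`, at the valuation `j`, either two of them have the same norm, or
`m` is the dominating one and `k` the second. The colour records which. -/
def IsColour (φ : ℚ[X]) (p : ℕ) (j : ℤ) (c : Bool × ℕ × ℕ) : Prop :=
  c.2.1 ∈ φ.support ∧ c.2.2 ∈ φ.support ∧ c.2.1 ≠ c.2.2 ∧
    let t : ℕ → ℚ := fun l => padicNorm p (φ.coeff l) * ((p : ℚ) ^ (-j)) ^ l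
    if c.1 then t c.2.1 = t c.2.2
    else t c.2.2 < t c.2.1 ∧ ∀ l ∈ φ.support, l ≠ c.2.1 → l ≠ c.2.2 → t l < t c.2.2

lemma exists_isColour (φ : ℚ[X]) (p : ℕ) (h1 : 1 ≤ φ.natDegree) (h0 : φ.eval 0 ≠ 0) (j : ℤ) :
    ∃ c, IsColour φ p j c := by
  set t : ℕ → ℚ := fun l => padicNorm p (φ.coeff l) * ((p : ℚ) ^ (-j)) ^ l with ht
  by_cases hinj : ∃ k ∈ φ.support, ∃ l ∈ φ.support, k ≠ l ∧ t k = t l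
  · obtain ⟨k, hk, l, hl, hkl, he⟩ := hinj
    refine ⟨(true, k, l), hk, hl, hkl, ?_⟩
    simp only [if_true]
    exact he
  · push Not at hinj
    have hz : 0 ∈ φ.support := by
      rw [mem_support_iff, coeff_zero_eq_eval_zero]; exact h0
    have hd : φ.natDegree ∈ φ.support := natDegree_mem_support_of_nonzero (by
      rintro rfl; simp at h1)
    obtain ⟨m, hm, hmax⟩ := φ.support.exists_max_image t ⟨0, hz⟩
    -- A second monomial exists because the constant and the leading one are different members of
    -- the support.
    have hne : (φ.support.erase m).Nonempty := by
      rcases eq_or_ne m 0 with rfl | hm0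
      · exact ⟨φ.natDegree, Finset.mem_erase.2 ⟨by omega, hd⟩⟩
      · exact ⟨0, Finset.mem_erase.2 ⟨hm0.symm, hz⟩⟩
    obtain ⟨k, hk, hkmax⟩ := (φ.support.erase m).exists_max_image t hne
    have hk' := Finset.mem_erase.1 hk
    refine ⟨(false, m, k), hm, hk'.2, hk'.1.symm, ?_⟩
    simp only [Bool.false_eq_true, if_false]
    exact ⟨lt_of_le_of_ne (hmax k hk'.2) (hinj k hk'.2 m hm hk'.1), fun l hl hlm hlk =>
      lt_of_le_of_ne (hkmax l (Finset.mem_erase.2 ⟨hlm, hl⟩)) (hinj l hl k hk'.2 hlk)⟩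

/-- After division by the dominant monomial, the second largest strictly exceeds all the remaining
ones, so by the ultrametric inequality it alone determines the norm of the error. -/
lemma padicNorm_div_sub_one_of_isColour {φ : ℚ[X]} {p : ℕ} [Fact p.Prime] {m k : ℕ} {a : ℚ}
    (ha : a ≠ 0) (h : IsColour φ p (padicValRat p a) (false, m, k)) :
    padicNorm p (φ.eval a / (φ.coeff m * a ^ m) - 1) =
        padicNorm p (φ.coeff k) * ((p : ℚ) ^ (-padicValRat p a)) ^ k /
          (padicNorm p (φ.coeff m) * ((p : ℚ) ^ (-padicValRat p a)) ^ m) ∧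
      0 < padicNorm p (φ.eval a / (φ.coeff m * a ^ m) - 1) ∧
      padicNorm p (φ.eval a / (φ.coeff m * a ^ m) - 1) < 1 := by
  obtain ⟨hm, hk, hmk, h⟩ := h
  simp only [Bool.false_eq_true, if_false] at hm hk hmk h
  rw [← padicNorm.eq_zpow_of_nonzero ha] at h ⊢
  have hnorm : ∀ l, padicNorm p (φ.coeff l) * padicNorm p a ^ l =
      padicNorm p (φ.coeff l * a ^ l) := by
    intro l
    rw [padicNorm.mul]
    congr 1
    induction l with
    | zero => simp
    | succ l ih => rw [pow_succ, pow_succ, padicNorm.mul, ih]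
  simp only [hnorm] at h ⊢
  have hpos : ∀ l ∈ φ.support, φ.coeff l * a ^ l ≠ 0 := fun l hl =>
    mul_ne_zero (mem_support_iff.1 hl) (pow_ne_zero _ ha)
  have hnpos : ∀ l ∈ φ.support, 0 < padicNorm p (φ.coeff l * a ^ l) := fun l hl =>
    lt_of_le_of_ne (padicNorm.nonneg _) (padicNorm.nonzero (hpos l hl)).symm
  have hk' : k ∈ φ.support.erase m := Finset.mem_erase.2 ⟨hmk.symm, hk⟩
  have heq : φ.eval a / (φ.coeff m * a ^ m) - 1 = (φ.coeff k * a ^ k +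
      ∑ l ∈ (φ.support.erase m).erase k, φ.coeff l * a ^ l) / (φ.coeff m * a ^ m) := by
    have : φ.eval a = φ.coeff m * a ^ m + (φ.coeff k * a ^ k +
        ∑ l ∈ (φ.support.erase m).erase k, φ.coeff l * a ^ l) := by
      rw [Finset.add_sum_erase _ (fun l => φ.coeff l * a ^ l) hk',
        Finset.add_sum_erase _ (fun l => φ.coeff l * a ^ l) hm, eval_eq_sum, sum_def]
    rw [this, add_div, div_self (hpos m hm)]
    ring
  have hrest : padicNorm p (∑ l ∈ (φ.support.erase m).erase k, φ.coeff l * a ^ l) <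
      padicNorm p (φ.coeff k * a ^ k) := by
    refine padicNorm.sum_lt' (fun l hl => ?_) (hnpos k hk)
    have hl' := Finset.mem_erase.1 (Finset.mem_of_mem_erase hl)
    exact h.2 l hl'.2 hl'.1 (Finset.ne_of_mem_erase hl)
  have e : padicNorm p (φ.eval a / (φ.coeff m * a ^ m) - 1) =
      padicNorm p (φ.coeff k * a ^ k) / padicNorm p (φ.coeff m * a ^ m) := by
    rw [heq, padicNorm.div, padicNorm.add_eq_max_of_ne hrest.ne', max_eq_left hrest.le]
  refine ⟨e, ?_, ?_⟩
  · rw [e]; exact div_pos (hnpos k hk) (hnpos m hm)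
  · rw [e, div_lt_one (hnpos m hm)]; exact h.1

/-- On each colour class there is an injective function of the valuation whose maximum is never
attained exactly once on a solution. -/
theorem exists_injOn_of_isColour {s : ℕ} (hs : 1 ≤ s) (φ : ℚ[X]) (p : ℕ) [Fact p.Prime]
    (c : Bool × ℕ × ℕ) :
    ∃ f : ℤ → ℚ, Set.InjOn f {j | IsColour φ p j c} ∧
      ∀ (i₀ : Fin (s + s)) (a : Fin (s + s) → ℚ),
        (∀ i, a i ≠ 0 ∧ IsColour φ p (padicValRat p (a i)) c) →
        (∀ i, i ≠ i₀ → f (padicValRat p (a i)) < f (padicValRat p (a i₀))) →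
        ¬ IsSolution φ a := by
  have hp : p.Prime := Fact.out
  have hp0 : (0 : ℚ) < p := by exact_mod_cast hp.pos
  have hp1 : (p : ℚ) ≠ 1 := by exact_mod_cast hp.one_lt.ne'
  have hu : ∀ j : ℤ, (0 : ℚ) < (p : ℚ) ^ (-j) := fun j => zpow_pos hp0 _
  have huinj : ∀ j j' : ℤ, (p : ℚ) ^ (-j) = (p : ℚ) ^ (-j') → j = j' := fun j j' h =>
    neg_injective (zpow_right_injective₀ hp0 hp1 h)
  have hcpos : ∀ l ∈ φ.support, 0 < padicNorm p (φ.coeff l) := fun l hl =>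
    lt_of_le_of_ne (padicNorm.nonneg _) (padicNorm.nonzero (mem_support_iff.1 hl)).symm
  obtain ⟨b, m, k⟩ := c
  cases b with
  | true =>
    -- A tie between two monomials of different degrees determines the norm of `a`, so such a colour
    -- contains at most one valuation. A constant `f` is then injective on it, and has no unique
    -- maximum because `2s ≥ 2`.
    have hsub : ∀ j j', IsColour φ p j (true, m, k) → IsColour φ p j' (true, m, k) → j = j' := by
      rintro j j' ⟨hm, hk, hmk, h⟩ ⟨-, -, -, h'⟩
      simp only [if_true] at hm hk hmk h h'
      refine huinj j j' (eq_of_pow_mul_pow_eq (hu j) (hu j') hmk ?_)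
      have := hcpos m hm
      have := hcpos k hk
      have h3 : padicNorm p (φ.coeff m) * padicNorm p (φ.coeff k) *
          (((p : ℚ) ^ (-j)) ^ m * ((p : ℚ) ^ (-j')) ^ k) =
          padicNorm p (φ.coeff m) * padicNorm p (φ.coeff k) *
          (((p : ℚ) ^ (-j')) ^ m * ((p : ℚ) ^ (-j)) ^ k) := by
        linear_combination h * (padicNorm p (φ.coeff k) * ((p : ℚ) ^ (-j')) ^ k) -
          h' * (padicNorm p (φ.coeff k) * ((p : ℚ) ^ (-j)) ^ k)
      exact mul_left_cancel₀ (by positivity) h3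
    refine ⟨fun _ => 0, fun j hj j' hj' _ => hsub j j' hj hj', fun i₀ a _ hlt => ?_⟩
    have : Nontrivial (Fin (s + s)) := Fin.nontrivial_iff_two_le.2 (by omega)
    obtain ⟨i, hi⟩ := exists_ne i₀
    exact absurd (hlt i hi) (lt_irrefl _)
  | false =>
    refine ⟨fun j => padicNorm p (φ.coeff k) * ((p : ℚ) ^ (-j)) ^ k /
          (padicNorm p (φ.coeff m) * ((p : ℚ) ^ (-j)) ^ m), ?_, ?_⟩
    · rintro j ⟨hm, hk, hmk, -⟩ j' - h
      simp only at hm hk hmk h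
      refine huinj j j' (eq_of_pow_mul_pow_eq (hu j) (hu j') hmk.symm ?_)
      have := hcpos m hm
      have := hcpos k hk
      have := hu j
      have := hu j'
      rw [div_eq_div_iff (by positivity) (by positivity)] at h
      have h3 : padicNorm p (φ.coeff m) * padicNorm p (φ.coeff k) *
          (((p : ℚ) ^ (-j)) ^ k * ((p : ℚ) ^ (-j')) ^ m) =
          padicNorm p (φ.coeff m) * padicNorm p (φ.coeff k) *
          (((p : ℚ) ^ (-j')) ^ k * ((p : ℚ) ^ (-j)) ^ m) := by linear_combination h
      exact mul_left_cancel₀ (by positivity) h3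
    · rintro i₀ a ha hlt ⟨hs1, hs2⟩
      have hN := fun i => padicNorm_div_sub_one_of_isColour (ha i).1 (ha i).2
      simp only [← (hN _).1] at hlt
      set ε : Fin (s + s) → ℚ := fun i => φ.eval (a i) / (φ.coeff m * a i ^ m) - 1 with hε
      -- The second equation is divided by the `m`-th power of the first; the coefficients of the
      -- dominant monomials cancel since both sides have `s` of them.
      have hprod : ∏ i : Fin s, (1 + ε (Fin.castAdd s i)) =
          ∏ i : Fin s, (1 + ε (Fin.natAdd s i)) := by
        simp only [hε, add_sub_cancel]
        rw [Finset.prod_div_distrib, Finset.prod_div_distrib, Finset.prod_mul_distrib,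
          Finset.prod_mul_distrib, Finset.prod_pow, Finset.prod_pow, hs1, hs2]
      have hne : ∀ i i' : Fin s, Fin.castAdd s i ≠ Fin.natAdd s i' := by
        intro i i' hc
        have := congrArg Fin.val hc
        simp only [Fin.val_natAdd, Fin.val_castAdd] at this
        omega
      induction i₀ using Fin.addCases with
      | left i₁ =>
        exact prod_one_add_ne_of_unique_max Finset.univ Finset.univ
          (fun i => ε (Fin.castAdd s i)) (fun i => ε (Fin.natAdd s i)) i₁ (Finset.mem_univ _)
          (hN _).2.1 (hN _).2.2
          (fun i _ hi => hlt _ fun hc => hi (Fin.castAdd_injective s s hc))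
          (fun i _ => hlt _ (hne _ _).symm) hprod
      | right i₁ =>
        exact prod_one_add_ne_of_unique_max Finset.univ Finset.univ
          (fun i => ε (Fin.natAdd s i)) (fun i => ε (Fin.castAdd s i)) i₁ (Finset.mem_univ _)
          (hN _).2.1 (hN _).2.2
          (fun i _ hi => hlt _ fun hc => hi (Fin.natAdd_injective s s hc))
          (fun i _ => hlt _ (hne _ _)) hprod.symm

/-! ### Orthogonal characters of the nonzero rationals -/

/-- The character `x ↦ ζ ^ v_p(x)` of the nonzero rationals, extended by zero. -/
noncomputable def valuationCharacter (p : ℕ) [Fact p.Prime] (ζ : ℂ) (hζ : ζ ≠ 0) : ℚ →* ℂ where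
  toFun x := if x = 0 then 0 else ζ ^ padicValRat p x
  map_one' := by simp
  map_mul' x y := by
    by_cases hx : x = 0
    · simp [hx]
    by_cases hy : y = 0
    · simp [hy]
    simp [hx, hy, padicValRat.mul hx hy, zpow_add₀ hζ]

lemma eq_one_or_neg_one_of_padicValRat {u : ℚ} (h0 : u ≠ 0)
    (h : ∀ p : ℕ, p.Prime → padicValRat p u = 0) : u = 1 ∨ u = -1 := by
  have hnum : u.num.natAbs = 1 := by
    by_contra hne
    obtain ⟨p, hp, hpd⟩ := Nat.exists_prime_and_dvd hne
    have : Fact p.Prime := ⟨hp⟩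
    have hden : ¬ p ∣ u.den := fun hd => hp.one_lt.ne' (Nat.dvd_one.1
      (u.reduced ▸ Nat.dvd_gcd hpd hd))
    have h1 := h p hp
    rw [padicValRat_def, padicValNat.eq_zero_of_not_dvd hden] at h1
    have h2 : 1 ≤ padicValNat p u.num.natAbs :=
      one_le_padicValNat_of_dvd (by simpa using h0) hpd
    rw [padicValInt] at h1
    omega
  have hden : u.den = 1 := by
    by_contra hne
    obtain ⟨p, hp, hpd⟩ := Nat.exists_prime_and_dvd hne
    have : Fact p.Prime := ⟨hp⟩
    have h1 := h p hp
    rw [padicValRat_def, padicValInt, hnum, padicValNat_one_right] at h1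
    have h2 : 1 ≤ padicValNat p u.den := one_le_padicValNat_of_dvd u.den_nz hpd
    omega
  have hu : u = u.num := (Rat.den_eq_one_iff u).1 hden |>.symm
  rcases Int.natAbs_eq_iff.1 hnum with h1 | h1 <;> rw [hu, h1] <;> simp

/-- The sign detects `-1`. Any other `u ≠ 1` has a nonzero valuation, detected by a root of unity of
order larger than its absolute value. The finite order `N` later makes a geometric sum vanish. -/
lemma exists_character_ne_one {u : ℚ} (h0 : u ≠ 0) (h1 : u ≠ 1) :
    ∃ N : ℕ, 0 < N ∧ ∃ χ : ℚ →* ℂ, χ u ≠ 1 ∧ ∀ x, x ≠ 0 → χ x ^ N = 1 := by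
  by_cases h : ∀ p : ℕ, p.Prime → padicValRat p u = 0
  · have hu : u = -1 := (eq_one_or_neg_one_of_padicValRat h0 h).resolve_left h1
    refine ⟨2, by norm_num, (SignType.castHom (α := ℂ)).toMonoidHom.comp
      (signHom (α := ℚ)).toMonoidHom, ?_, fun x hx => ?_⟩
    · subst hu
      norm_num
    · rcases lt_or_gt_of_ne hx with hx | hx <;> simp [hx]
  · push Not at h
    obtain ⟨p, hp, hv⟩ := h
    have : Fact p.Prime := ⟨hp⟩
    set N := (padicValRat p u).natAbs + 1 with hN
    have hζ := Complex.isPrimitiveRoot_exp N (by omega)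
    set ζ := Complex.exp (2 * Real.pi * Complex.I / N)
    have hζ0 : ζ ≠ 0 := hζ.ne_zero (by omega)
    refine ⟨N, by omega, valuationCharacter p ζ hζ0, ?_, fun x hx => ?_⟩
    · simp only [valuationCharacter, MonoidHom.coe_mk, OneHom.coe_mk, h0, if_false]
      rw [Ne, hζ.zpow_eq_one_iff_dvd]
      intro hd
      have := Int.natAbs_dvd_natAbs.2 hd
      have := Nat.le_of_dvd (by omega) this
      simp only [Int.natAbs_natCast] at this
      omega
    · simp only [valuationCharacter, MonoidHom.coe_mk, OneHom.coe_mk, hx, if_false]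
      rw [← zpow_natCast, ← zpow_mul, mul_comm, zpow_mul, zpow_natCast, hζ.pow_eq_one, one_zpow]

lemma exists_character_pair_ne_one (z : ℚ × ℚ) :
    ∃ (N : ℕ) (χ ψ : ℚ →* ℂ), 0 < N ∧ (z.1 ≠ 0 → z.2 ≠ 0 → z ≠ 1 → χ z.1 * ψ z.2 ≠ 1) ∧
      (∀ x, x ≠ 0 → χ x ^ N = 1) ∧ ∀ x, x ≠ 0 → ψ x ^ N = 1 := by
  by_cases h1 : z.1 ≠ 0 ∧ z.1 ≠ 1
  · obtain ⟨N, hN, χ, h, hχ⟩ := exists_character_ne_one h1.1 h1.2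
    exact ⟨N, χ, 1, hN, fun _ _ _ => by simpa using h, hχ, fun _ _ => by simp⟩
  by_cases h2 : z.2 ≠ 0 ∧ z.2 ≠ 1
  · obtain ⟨N, hN, χ, h, hχ⟩ := exists_character_ne_one h2.1 h2.2
    exact ⟨N, 1, χ, hN, fun _ _ _ => by simpa using h, fun _ _ => by simp, hχ⟩
  · refine ⟨1, 1, 1, one_pos, fun a b c => absurd (Prod.ext ?_ ?_) c, by simp, by simp⟩
    · by_contra hc
      exact h1 ⟨a, hc⟩
    · by_contra hc
      exact h2 ⟨b, hc⟩

/-- A finite family of pairs of unimodular characters of the nonzero rationals that is orthogonal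
on a given finite set. -/
theorem exists_orthogonal_characters (S : Finset (ℚ × ℚ)) (hS : ∀ z ∈ S, z.1 ≠ 0 ∧ z.2 ≠ 0) :
    ∃ (Ω : Type) (_ : Fintype Ω) (χ ψ : Ω → ℚ →* ℂ), 0 < Fintype.card Ω ∧
      (∀ ω x, x ≠ 0 → ‖χ ω x‖ = 1) ∧ (∀ ω x, x ≠ 0 → ‖ψ ω x‖ = 1) ∧
      ∀ z ∈ S, ∑ ω, χ ω z.1 * ψ ω z.2 = if z = 1 then (Fintype.card Ω : ℂ) else 0 := by
  choose N χ ψ hN hne hχ hψ using exists_character_pair_ne_one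
  have hnorm : ∀ (n : ℕ) (θ : ℚ →* ℂ), 0 < n → (∀ x, x ≠ 0 → θ x ^ n = 1) →
      ∀ x, x ≠ 0 → ‖θ x‖ = 1 := fun n θ hn h x hx =>
    (pow_eq_one_iff_of_nonneg (norm_nonneg _) hn.ne').1 (by rw [← norm_pow, h x hx, norm_one])
  refine ⟨∀ z : S, Fin (N z), inferInstance, fun ω => ∏ z : S, χ z ^ (ω z : ℕ),
    fun ω => ∏ z : S, ψ z ^ (ω z : ℕ), ?_, ?_, ?_, ?_⟩
  · have : ∀ z : S, Nonempty (Fin (N z)) := fun z => ⟨⟨0, hN z⟩⟩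
    exact Fintype.card_pos
  · intro ω x hx
    simp [norm_prod, hnorm _ _ (hN _) (hχ _) x hx]
  · intro ω x hx
    simp [norm_prod, hnorm _ _ (hN _) (hψ _) x hx]
  · intro y hy
    obtain ⟨hy1, hy2⟩ := hS y hy
    -- `Ω` is a box with one coordinate for each `z` in `S`, so the sum factors; for `y ≠ 1` the
    -- factor at `y` is a full geometric sum and vanishes.
    have h1 : ∑ ω : ∀ z : S, Fin (N z), (∏ z : S, χ z ^ (ω z : ℕ)) y.1 *
        (∏ z : S, ψ z ^ (ω z : ℕ)) y.2 =
        ∏ z : S, ∑ t : Fin (N z), (χ z y.1 * ψ z y.2) ^ (t : ℕ) := by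
      rw [Fintype.prod_sum]
      refine Finset.sum_congr rfl fun ω _ => ?_
      simp only [MonoidHom.finsetProd_apply, MonoidHom.pow_apply, mul_pow,
        Finset.prod_mul_distrib]
    rw [h1]
    split_ifs with h
    · subst h
      simp
    · refine Finset.prod_eq_zero (Finset.mem_univ ⟨y, hy⟩) ?_
      have hz := hne y hy1 hy2 h
      rw [Fin.sum_univ_eq_sum_range (fun t => (χ y y.1 * ψ y y.2) ^ t)]
      rw [geom_sum_eq hz, mul_pow, hχ y _ hy1, hψ y _ hy2]
      simp

/-! ### Moments over sets without deep trees -/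

section recursion

variable {Ω : Type*} [Fintype Ω] {s d : ℕ} {φ : ℚ[X]} {A : Finset ℚ}
  {w : ℚ → ℝ} {e : Ω → ℚ → ℂ}

lemma evenNorm_sq_le_of_norm_le (hs : 1 ≤ s) {F : Ω → ℂ} {c : ℝ} (hc : 0 ≤ c)
    (h : ∀ ω, ‖F ω‖ ≤ c) : evenNorm s F ^ 2 ≤ c ^ 2 * evenNorm s (1 : Ω → ℂ) ^ 2 := by
  rw [← mul_pow]
  refine pow_le_pow_left₀ (evenNorm_nonneg hs _) ?_ 2
  refine le_of_pow_le_pow_left₀ (by omega : s + s ≠ 0)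
    (mul_nonneg hc (evenNorm_nonneg hs _)) ?_
  rw [mul_pow, evenNorm_pow hs, evenNorm_pow hs, Finset.mul_sum]
  refine Finset.sum_le_sum fun ω _ => ?_
  simpa using pow_le_pow_left₀ (norm_nonneg _) (h ω) (s + s)

/-- The norm uses counting measure; this factor is carried through the recursion and finally cancels
against the number of characters. -/
lemma evenNorm_one_sq_pow (hs : 1 ≤ s) :
    (evenNorm s (1 : Ω → ℂ) ^ 2) ^ s = Fintype.card Ω := by
  rw [← pow_mul, two_mul, evenNorm_pow hs]
  simp

lemma evenNorm_phaseSum_sq_le_card_mul (hs : 1 ≤ s) {B : Finset ℚ}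
    (he : ∀ ω, ∀ a ∈ B, ‖e ω a‖ ≤ 1) :
    evenNorm s (phaseSum w e B) ^ 2 ≤
      B.card * (evenNorm s (1 : Ω → ℂ) ^ 2 * ∑ a ∈ B, w a ^ 2) := by
  refine (evenNorm_sum_sq_le hs B fun a ω => (w a : ℂ) * e ω a).trans ?_
  gcongr
  rw [Finset.mul_sum]
  refine Finset.sum_le_sum fun a ha => ?_
  rw [mul_comm, ← sq_abs (w a)]
  refine evenNorm_sq_le_of_norm_le hs (abs_nonneg _) fun ω => ?_
  rw [norm_mul, Complex.norm_real, Real.norm_eq_abs]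
  exact mul_le_of_le_one_right (abs_nonneg _) (he ω a ha)

/-- Splitting into the fibres of a `p`-adic valuation costs a factor depending on `s` and `d`. -/
theorem evenNorm_phaseSum_sq_le_sum_padicFiber (hs : 1 ≤ s) (hd : φ.natDegree ≤ d)
    (h1 : 1 ≤ φ.natDegree) (h0 : φ.eval 0 ≠ 0) (hA : ∀ a ∈ A, a ≠ 0)
    (horth : ∀ a : Fin (s + s) → ℚ, (∀ i, a i ∈ A) → ¬ IsSolution φ a →
      ∑ ω, ∏ i, halfConj i (e ω (a i)) = 0)
    (p : ℕ) [Fact p.Prime] {R : Finset ℚ} (hR : R ⊆ A) :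
    evenNorm s (phaseSum w e R) ^ 2 ≤ 2 * ((d : ℝ) + 1) ^ 2 * (8 * s) *
      ∑ j ∈ R.image (padicValRat p), evenNorm s (phaseSum w e (padicFiber p j R)) ^ 2 := by
  choose κ hκ using exists_isColour φ p h1 h0
  -- There are at most `2 * (d + 1) ^ 2` colours, and Cauchy–Schwarz over them costs this number.
  set Cs : Finset (Bool × ℕ × ℕ) :=
    Finset.univ ×ˢ Finset.range (d + 1) ×ˢ Finset.range (d + 1) with hCs
  have hmem : ∀ j, κ j ∈ Cs := by
    intro j
    obtain ⟨ha, hb, -⟩ := hκ j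
    have := le_natDegree_of_mem_supp _ ha
    have := le_natDegree_of_mem_supp _ hb
    simp only [hCs, Finset.mem_product, Finset.mem_univ, Finset.mem_range, true_and]
    omega
  have hcard : (Cs.card : ℝ) = 2 * ((d : ℝ) + 1) ^ 2 := by
    simp only [hCs, Finset.card_product, Finset.card_univ, Fintype.card_bool, Finset.card_range]
    push_cast
    ring
  let J : Bool × ℕ × ℕ → Finset ℤ := fun c => (R.image (padicValRat p)).filter fun j => κ j = c
  have hsplit : phaseSum w e R = fun ω => ∑ c ∈ Cs,
      phaseSum w e (R.filter fun a => padicValRat p a ∈ J c) ω := by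
    ext ω
    have hJ : ∀ c, (R.filter fun a => padicValRat p a ∈ J c) =
        R.filter fun a => κ (padicValRat p a) = c := by
      intro c
      refine Finset.filter_congr fun a ha => ?_
      simp only [J, Finset.mem_filter, and_iff_right_iff_imp]
      exact fun _ => Finset.mem_image_of_mem _ ha
    simp only [phaseSum, hJ]
    exact (Finset.sum_fiberwise_of_maps_to (fun a _ => hmem _) _).symm
  have hcol : ∀ c ∈ Cs, evenNorm s (phaseSum w e (R.filter fun a => padicValRat p a ∈ J c)) ^ 2 ≤
      8 * s * ∑ j ∈ J c, evenNorm s (phaseSum w e (padicFiber p j R)) ^ 2 := by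
    intro c _
    obtain ⟨f, hf, hsol⟩ := exists_injOn_of_isColour hs φ p c
    have hJc : ∀ j ∈ J c, IsColour φ p j c := fun j hj => by
      have := hκ j
      rwa [(Finset.mem_filter.1 hj).2] at this
    refine evenNorm_phaseSum_biUnion_sq_le hs w e (padicValRat p) f R (J c)
      (hf.mono fun j hj => hJc j hj) fun i₀ a ha hlt => ?_
    exact horth a (fun i => hR (ha i).1)
      (hsol i₀ a (fun i => ⟨hA _ (hR (ha i).1), hJc _ (ha i).2⟩) hlt)
  rw [hsplit]
  refine (evenNorm_sum_sq_le hs Cs _).trans ?_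
  rw [hcard, mul_assoc (2 * ((d : ℝ) + 1) ^ 2)]
  gcongr
  refine (Finset.sum_le_sum hcol).trans ?_
  rw [← Finset.mul_sum, Finset.sum_fiberwise_of_maps_to (fun j _ => hmem j)]

lemma card_le_two_of_padicValRat_eq {B : Finset ℚ} (hB : ∀ a ∈ B, a ≠ 0)
    (h : ∀ p : ℕ, p.Prime → ∀ a ∈ B, ∀ b ∈ B, padicValRat p a = padicValRat p b) :
    B.card ≤ 2 := by
  rcases B.eq_empty_or_nonempty with rfl | ⟨b, hb⟩
  · simp
  refine (Finset.card_le_card (t := {b, -b}) fun a ha => ?_).trans Finset.card_le_two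
  have hab : a / b = 1 ∨ a / b = -1 := by
    refine eq_one_or_neg_one_of_padicValRat (div_ne_zero (hB a ha) (hB b hb)) fun p hp => ?_
    have : Fact p.Prime := ⟨hp⟩
    rw [padicValRat.div (hB a ha) (hB b hb), h p hp a ha b hb, sub_self]
  have hb0 := hB b hb
  simp only [Finset.mem_insert, Finset.mem_singleton]
  rcases hab with h | h
  · left; field_simp at h; exact h
  · right; field_simp at h; exact h

/-- A set without deep binary trees of `p`-adic fibres has a small `2s`-th moment. -/
theorem evenNorm_phaseSum_sq_le_of_not_hasPadicTree (hs : 1 ≤ s) (hd : φ.natDegree ≤ d)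
    (h1 : 1 ≤ φ.natDegree) (h0 : φ.eval 0 ≠ 0) (hA : ∀ a ∈ A, a ≠ 0)
    (he : ∀ ω, ∀ a ∈ A, ‖e ω a‖ ≤ 1)
    (horth : ∀ a : Fin (s + s) → ℚ, (∀ i, a i ∈ A) → ¬ IsSolution φ a →
      ∑ ω, ∏ i, halfConj i (e ω (a i)) = 0) (n : ℕ) :
    ∀ B ⊆ A, ¬ HasPadicTree n B → evenNorm s (phaseSum w e B) ^ 2 ≤
      2 * (2 * ((d : ℝ) + 1) ^ 2 * (8 * s) ^ 2) ^ n *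
        (evenNorm s (1 : Ω → ℂ) ^ 2 * ∑ a ∈ B, w a ^ 2) := by
  set Λ : ℝ := 2 * ((d : ℝ) + 1) ^ 2 * (8 * s) ^ 2 with hΛ
  set W : ℝ := evenNorm s (1 : Ω → ℂ) ^ 2 with hW
  have hW0 : 0 ≤ W := by positivity
  have hs1 : (1 : ℝ) ≤ s := by exact_mod_cast hs
  have hΛ1 : 1 ≤ Λ := by
    have a1 : (1 : ℝ) ≤ ((d : ℝ) + 1) ^ 2 := one_le_pow₀ (by linarith [Nat.cast_nonneg (α := ℝ) d])
    have a2 : (1 : ℝ) ≤ (8 * s) ^ 2 := one_le_pow₀ (by linarith)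
    nlinarith
  induction n with
  | zero =>
    intro B _ hn
    have hB : B = ∅ := Finset.not_nonempty_iff_eq_empty.1 hn
    subst hB
    have : phaseSum w e ∅ = 0 := by ext ω; simp [phaseSum]
    rw [this, evenNorm_zero hs]
    simp
  | succ n ih =>
    -- The exceptional fibre is smaller but may have the same depth, whence the inner induction on
    -- the set. Its coefficient must be one, as the number of such steps is not controlled.
    intro B
    induction B using Finset.strongInduction with
    | H B ihB =>
    intro hBA hn
    by_cases hsep : ∀ p : ℕ, p.Prime → ∀ a ∈ B, ∀ b ∈ B, padicValRat p a = padicValRat p b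
    · have hc : (B.card : ℝ) ≤ 2 := by
        exact_mod_cast card_le_two_of_padicValRat_eq (fun a ha => hA a (hBA ha)) hsep
      refine (evenNorm_phaseSum_sq_le_card_mul hs fun ω a ha => he ω a (hBA ha)).trans ?_
      have hpow : (1 : ℝ) ≤ Λ ^ (n + 1) := one_le_pow₀ hΛ1
      have : 0 ≤ ∑ a ∈ B, w a ^ 2 := by positivity
      gcongr
      linarith
    · push Not at hsep
      obtain ⟨p, hp, a, ha, b, hb, hab⟩ := hsep
      have : Fact p.Prime := ⟨hp⟩
      -- Two fibres with trees of depth `n` would give `B` one of depth `n + 1`. In the proof, the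
      -- value `0` is only an arbitrary start for finding two different indices.
      obtain ⟨j₀, hj₀⟩ : ∃ j₀, ∀ j, j ≠ j₀ → ¬ HasPadicTree n (padicFiber p j B) := by
        by_contra! hc
        obtain ⟨i, -, hi⟩ := hc 0
        obtain ⟨j, hji, hj⟩ := hc i
        exact hn ⟨p, hp, j, i, hji, hj, hi⟩
      set R := B.filter fun a => padicValRat p a ≠ j₀ with hR
      have hRB : R ⊆ B := Finset.filter_subset _ _
      have hdis : Disjoint (padicFiber p j₀ B) R := Finset.disjoint_filter_filter_not _ _ _
      have hun : padicFiber p j₀ B ∪ R = B := Finset.filter_union_filter_not_eq _ _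
      have hss : padicFiber p j₀ B ⊂ B := by
        refine (padicFiber_subset _ _ _).ssubset_of_ne fun heq => hab ?_
        rw [← heq] at ha hb
        rw [(mem_padicFiber.1 ha).2, (mem_padicFiber.1 hb).2]
      have hmain := ihB _ hss (hss.1.trans hBA) fun h => hn (h.mono hss.1)
      have hrest : evenNorm s (phaseSum w e R) ^ 2 ≤ 2 * ((d : ℝ) + 1) ^ 2 * (8 * s) *
          (2 * Λ ^ n * (W * ∑ a ∈ R, w a ^ 2)) := by
        refine (evenNorm_phaseSum_sq_le_sum_padicFiber hs hd h1 h0 hA horth p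
          (hRB.trans hBA)).trans ?_
        gcongr
        have hfib : ∑ a ∈ R, w a ^ 2 =
            ∑ j ∈ R.image (padicValRat p), ∑ a ∈ padicFiber p j R, w a ^ 2 :=
          (Finset.sum_fiberwise_of_maps_to (fun a ha => Finset.mem_image_of_mem _ ha) _).symm
        rw [hfib, Finset.mul_sum, Finset.mul_sum]
        refine Finset.sum_le_sum fun j hj => ?_
        refine ih _ (((padicFiber_subset _ _ _).trans hRB).trans hBA) fun h => ?_
        obtain ⟨c, hc, rfl⟩ := Finset.mem_image.1 hj
        exact hj₀ _ (Finset.mem_filter.1 hc).2 (h.mono (Finset.filter_subset_filter _ hRB))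
      have hsplit := evenNorm_phaseSum_union_sq_le hs w e hdis (by
        intro i₀ a h2 h3
        have h4 : ∀ i, a i ∈ B := fun i => by
          rcases eq_or_ne i i₀ with rfl | hi
          · exact hRB h2
          · exact padicFiber_subset _ _ _ (h3 i hi)
        exact horth a (fun i => hBA (h4 i)) (not_isSolution_of_valuation
          (fun i => hA _ (hBA (h4 i))) i₀ (Finset.mem_filter.1 h2).2
          fun i hi => (mem_padicFiber.1 (h3 i hi)).2))
      rw [hun] at hsplit
      have hsum : ∑ a ∈ B, w a ^ 2 = ∑ a ∈ padicFiber p j₀ B, w a ^ 2 + ∑ a ∈ R, w a ^ 2 := by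
        rw [← Finset.sum_union hdis, hun]
      calc evenNorm s (phaseSum w e B) ^ 2
          ≤ 2 * Λ ^ (n + 1) * (W * ∑ a ∈ padicFiber p j₀ B, w a ^ 2) +
            8 * s * (2 * ((d : ℝ) + 1) ^ 2 * (8 * s) * (2 * Λ ^ n * (W * ∑ a ∈ R, w a ^ 2))) := by
            refine hsplit.trans (add_le_add hmain ?_)
            gcongr
        -- One factor `8 * s` comes from splitting off `R`, the other from the square function
        -- estimate, and `2 * (d + 1) ^ 2` from the colours; together they make `Λ`.
        _ = 2 * Λ ^ (n + 1) * (W * ∑ a ∈ B, w a ^ 2) := by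
            rw [hsum, pow_succ, hΛ]
            ring

end recursion

/-! ### Consequences of small doubling -/

/-- Passing to units makes the Plünnecke–Ruzsa inequality for commutative groups applicable. -/
lemma exists_units_finset {A : Finset ℚ} (hA : ∀ a ∈ A, a ≠ 0) :
    ∃ U : Finset ℚˣ, U.card = A.card ∧ U.image (Units.coeHom ℚ) = A := by
  have hinj : Function.Injective (Units.coeHom ℚ) := Units.val_injective
  have himg : (A.preimage (Units.coeHom ℚ) hinj.injOn).image (Units.coeHom ℚ) = A := by
    ext a
    simp only [Finset.mem_image, Finset.mem_preimage]
    exact ⟨fun ⟨u, hu, h⟩ => h ▸ hu, fun ha => ⟨Units.mk0 a (hA a ha), ha, rfl⟩⟩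
  refine ⟨A.preimage (Units.coeHom ℚ) hinj.injOn, ?_, himg⟩
  rw [← Finset.card_image_of_injective _ hinj, himg]

lemma card_units_pow_div_pow_le {A : Finset ℚ} {U : Finset ℚˣ} {K : ℝ}
    (hU : U.card = A.card) (hUA : U.image (Units.coeHom ℚ) = A) (hne : A.Nonempty)
    (hK : ((A * A).card : ℝ) = K * A.card) (m n : ℕ) :
    ((U ^ m / U ^ n).card : ℝ) ≤ K ^ (m + n) * A.card := by
  have hinj : Function.Injective (Units.coeHom ℚ) := Units.val_injective
  have hpos : 0 < A.card := hne.card_pos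
  have hUne : U.Nonempty := by rw [← Finset.card_pos, hU]; exact hpos
  have hUU : (U * U).card = (A * A).card := by
    rw [← Finset.card_image_of_injective (U * U) hinj, Finset.image_mul, hUA]
  have h := Finset.pluennecke_ruzsa_inequality_pow_div_pow_mul hUne U m n
  rw [hUU, hU] at h
  have h' : ((U ^ m / U ^ n).card : ℝ) ≤ (((A * A).card : ℝ) / A.card) ^ (m + n) * A.card := by
    have h2 := (NNRat.cast_le (K := ℝ)).2 h
    push_cast at h2
    exact h2
  rwa [hK, mul_div_assoc, div_self (by exact_mod_cast hpos.ne'), mul_one] at h'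

lemma card_mul_mul_le {A : Finset ℚ} {K : ℝ} (hA : ∀ a ∈ A, a ≠ 0) (hne : A.Nonempty)
    (hK : ((A * A).card : ℝ) = K * A.card) : ((A * A * A).card : ℝ) ≤ K ^ 3 * A.card := by
  obtain ⟨U, hU, hUA⟩ := exists_units_finset hA
  have h := card_units_pow_div_pow_le hU hUA hne hK 3 0
  have hinj : Function.Injective (Units.coeHom ℚ) := Units.val_injective
  have hUUU : (U ^ 3).card = (A * A * A).card := by
    rw [← Finset.card_image_of_injective (U ^ 3) hinj, pow_succ, pow_two, Finset.image_mul,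
      Finset.image_mul, hUA]
  rwa [pow_zero, div_one, hUUU] at h

/-- The ratios `a_1 ⋯ a_s / (a_{s+1} ⋯ a_{2s})` with entries in `A` are few. -/
lemma exists_ratio_finset {A : Finset ℚ} {K : ℝ} (s : ℕ) (hA : ∀ a ∈ A, a ≠ 0)
    (hne : A.Nonempty) (hK : ((A * A).card : ℝ) = K * A.card) :
    ∃ R : Finset ℚ, (R.card : ℝ) ≤ K ^ (2 * s) * A.card ∧ (∀ r ∈ R, r ≠ 0) ∧
      ∀ a : Fin (s + s) → ℚ, (∀ i, a i ∈ A) →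
        (∏ i : Fin s, a (Fin.castAdd s i)) / (∏ i : Fin s, a (Fin.natAdd s i)) ∈ R := by
  obtain ⟨U, hU, hUA⟩ := exists_units_finset hA
  refine ⟨(U ^ s / U ^ s).image (Units.coeHom ℚ), ?_, ?_, ?_⟩
  · refine le_trans (Nat.cast_le.2 Finset.card_image_le) ?_
    rw [two_mul]
    exact card_units_pow_div_pow_le hU hUA hne hK s s
  · intro r hr
    obtain ⟨u, -, rfl⟩ := Finset.mem_image.1 hr
    exact u.ne_zero
  · intro a ha
    have hu : ∀ i, ∃ u ∈ U, (u : ℚ) = a i := fun i => by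
      have := ha i
      rw [← hUA] at this
      exact Finset.mem_image.1 this
    choose u huU hua using hu
    have hpow : ∀ f : Fin s → Fin (s + s), ∏ i, u (f i) ∈ U ^ s := fun f => by
      have hT : ∀ T : Finset (Fin s), ∏ i ∈ T, u (f i) ∈ U ^ T.card := by
        intro T
        induction T using Finset.induction_on with
        | empty => simp
        | insert i T hi ih =>
          rw [Finset.prod_insert hi, Finset.card_insert_of_notMem hi, pow_succ']
          exact Finset.mul_mem_mul (huU _) ih
      simpa using hT Finset.univ
    refine Finset.mem_image.2 ⟨_, Finset.div_mem_div (hpow (Fin.castAdd s)) (hpow (Fin.natAdd s)), ?_⟩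
    simp [← hua]

/-! ### Weighted counts as character averages -/

lemma prod_halfConj_character {s : ℕ} {θ : ℚ →* ℂ} (hθ : ∀ x, x ≠ 0 → ‖θ x‖ = 1)
    (x : Fin (s + s) → ℚ) (hx : ∀ i, x i ≠ 0) :
    ∏ i, halfConj i (θ (x i)) =
      θ ((∏ i : Fin s, x (Fin.castAdd s i)) / ∏ i : Fin s, x (Fin.natAdd s i)) := by
  have hconj : ∀ y, y ≠ 0 → starRingEnd ℂ (θ y) = θ y⁻¹ := by
    intro y hy
    have h1 : θ y * θ y⁻¹ = 1 := by rw [← map_mul, mul_inv_cancel₀ hy, map_one]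
    rw [← Complex.inv_eq_conj (hθ y hy)]
    exact inv_eq_of_mul_eq_one_right h1
  rw [prod_halfConj, div_eq_mul_inv, map_mul, map_prod, ← Finset.prod_inv_distrib, map_prod]
  congr 1
  exact Finset.prod_congr rfl fun i _ => hconj _ (hx _)

/-- The weighted count of the solutions of the product equation of the polynomials for which
moreover `x_1 ⋯ x_s = r x_{s+1} ⋯ x_{2s}`. -/
noncomputable def weightedRatioCount (s : ℕ) (w : ℚ → ℝ) (φ : Fin (s + s) → ℚ[X])
    (A : Finset ℚ) (r : ℚ) : ℝ :=
  ∑ a ∈ Fintype.piFinset (fun _ : Fin (s + s) => A),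
    if (∏ i : Fin s, a (Fin.castAdd s i)) = r * (∏ i : Fin s, a (Fin.natAdd s i)) ∧
        (∏ i : Fin s, (φ (Fin.castAdd s i)).eval (a (Fin.castAdd s i))) =
          ∏ i : Fin s, (φ (Fin.natAdd s i)).eval (a (Fin.natAdd s i))
    then ∏ i, w (a i) else 0

/-- The ratio `r` enters the character average only through the unimodular factor `χ ω r⁻¹`, so the
bound is uniform in `r`. Hölder then leaves one norm for each polynomial. -/
theorem weightedRatioCount_le {s d : ℕ} (hs : 1 ≤ s) {w : ℚ → ℝ} {φ : Fin (s + s) → ℚ[X]}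
    {A : Finset ℚ} (hdeg : ∀ i, 1 ≤ (φ i).natDegree ∧ (φ i).natDegree ≤ d)
    (h0 : ∀ i, (φ i).eval 0 ≠ 0) (hA : ∀ a ∈ A, a ≠ 0 ∧ ∀ i, (φ i).eval a ≠ 0)
    {n : ℕ} (hn : ¬ HasPadicTree n A) {r : ℚ} (hr : r ≠ 0) :
    weightedRatioCount s w φ A r ≤
      (2 * (2 * ((d : ℝ) + 1) ^ 2 * (8 * s) ^ 2) ^ n * ∑ a ∈ A, w a ^ 2) ^ s := by
  let ratio : (Fin (s + s) → ℚ) → ℚ := fun x =>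
    (∏ i : Fin s, x (Fin.castAdd s i)) / ∏ i : Fin s, x (Fin.natAdd s i)
  have hratio0 : ∀ x : Fin (s + s) → ℚ, (∀ i, x i ≠ 0) → ratio x ≠ 0 := fun x hx =>
    div_ne_zero (Finset.prod_ne_zero_iff.2 fun i _ => hx _)
      (Finset.prod_ne_zero_iff.2 fun i _ => hx _)
  -- One family of characters serves two purposes: `k = id` with `q = r` detects the counted tuples,
  -- and constant `k` with `q = 1` detects the solutions for a single polynomial.
  let pt : (Fin (s + s) → Fin (s + s)) × (Fin (s + s) → ℚ) × ℚ → ℚ × ℚ := fun x =>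
    (ratio x.2.1 / x.2.2, ratio fun i => (φ (x.1 i)).eval (x.2.1 i))
  set S : Finset (ℚ × ℚ) := ((Finset.univ : Finset (Fin (s + s) → Fin (s + s))) ×ˢ
    Fintype.piFinset (fun _ : Fin (s + s) => A) ×ˢ ({1, r} : Finset ℚ)).image pt with hS
  have hmemS : ∀ k a q, (∀ i, a i ∈ A) → (q = 1 ∨ q = r) → pt (k, a, q) ∈ S := by
    intro k a q ha hq
    refine Finset.mem_image_of_mem _ (Finset.mem_product.2 ⟨Finset.mem_univ _,
      Finset.mem_product.2 ⟨Fintype.mem_piFinset.2 ha, by simpa using hq⟩⟩)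
  have hS0 : ∀ z ∈ S, z.1 ≠ 0 ∧ z.2 ≠ 0 := by
    intro z hz
    obtain ⟨⟨k, a, q⟩, hx, rfl⟩ := Finset.mem_image.1 hz
    simp only [Finset.mem_product, Finset.mem_univ, true_and, Fintype.mem_piFinset,
      Finset.mem_insert, Finset.mem_singleton] at hx
    refine ⟨div_ne_zero (hratio0 _ fun i => (hA _ (hx.1 i)).1) ?_,
      hratio0 _ fun i => (hA _ (hx.1 i)).2 _⟩
    rcases hx.2 with h | h
    · exact h ▸ one_ne_zero
    · exact h ▸ hr
  obtain ⟨Ω, _, χ, ψ, hΩ, hχ, hψ, horth⟩ := exists_orthogonal_characters S hS0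
  let e : Fin (s + s) → Ω → ℚ → ℂ := fun k ω a => χ ω a * ψ ω ((φ k).eval a)
  have hprod : ∀ (k : Fin (s + s) → Fin (s + s)) (a : Fin (s + s) → ℚ) (ω : Ω),
      (∀ i, a i ∈ A) → ∏ i, halfConj i (e (k i) ω (a i)) =
        χ ω (ratio a) * ψ ω (ratio fun i => (φ (k i)).eval (a i)) := by
    intro k a ω ha
    simp only [e, map_mul]
    rw [Finset.prod_mul_distrib, prod_halfConj_character (hχ ω) a fun i => (hA _ (ha i)).1,
      prod_halfConj_character (hψ ω) (fun i => (φ (k i)).eval (a i)) fun i => (hA _ (ha i)).2 _]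
  have hone : ∀ x : Fin (s + s) → ℚ, (∀ i, x i ≠ 0) → ∀ q, q ≠ 0 → (ratio x / q = 1 ↔
      (∏ i : Fin s, x (Fin.castAdd s i)) = q * ∏ i : Fin s, x (Fin.natAdd s i)) := by
    intro x hx q hq
    rw [div_eq_one_iff_eq hq, div_eq_iff (Finset.prod_ne_zero_iff.2 fun i _ => hx _)]
  set W : ℝ := evenNorm s (1 : Ω → ℂ) ^ 2 with hW
  set Y : ℝ := 2 * (2 * ((d : ℝ) + 1) ^ 2 * (8 * s) ^ 2) ^ n * (W * ∑ a ∈ A, w a ^ 2) with hY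
  have hY0 : 0 ≤ Y := by positivity
  have hnorm : ∀ k, evenNorm s (phaseSum w (e k) A) ≤ √Y := by
    intro k
    refine Real.le_sqrt_of_sq_le ?_
    refine evenNorm_phaseSum_sq_le_of_not_hasPadicTree hs (hdeg k).2 (hdeg k).1 (h0 k)
      (fun a ha => (hA a ha).1) (fun ω a ha => ?_) (fun a ha hsol => ?_) n A subset_rfl hn
    · simp only [e, norm_mul]
      rw [hχ ω a (hA a ha).1, hψ ω _ ((hA a ha).2 k), one_mul]
    · rw [Finset.sum_congr rfl fun ω _ => hprod (fun _ => k) a ω ha]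
      have hz := horth _ (hmemS (fun _ => k) a 1 ha (Or.inl rfl))
      simp only [pt, div_one] at hz
      rw [hz, if_neg]
      intro hc
      rw [Prod.ext_iff] at hc
      have h1 := (hone a (fun i => (hA _ (ha i)).1) 1 one_ne_zero).1 (by rw [div_one]; exact hc.1)
      have h2 := (hone (fun i => (φ k).eval (a i)) (fun i => (hA _ (ha i)).2 _) 1 one_ne_zero).1
        (by rw [div_one]; exact hc.2)
      rw [one_mul] at h1 h2
      exact hsol ⟨h1, h2⟩
  have hcount : ((Fintype.card Ω * weightedRatioCount s w φ A r : ℝ) : ℂ) =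
      ∑ ω, χ ω r⁻¹ * ∏ i, halfConj i (phaseSum w (e i) A ω) := by
    simp only [prod_halfConj_phaseSum, Finset.mul_sum]
    rw [Finset.sum_comm, weightedRatioCount]
    push_cast
    rw [Finset.mul_sum]
    refine Finset.sum_congr rfl fun a ha => ?_
    rw [Fintype.mem_piFinset] at ha
    have hz := horth _ (hmemS id a r ha (Or.inr rfl))
    simp only [pt, id] at hz
    have hcomm : ∀ ω, χ ω r⁻¹ * (((∏ i, w (a i) : ℝ) : ℂ) * ∏ i, halfConj i (e i ω (a i))) =
        ((∏ i, w (a i) : ℝ) : ℂ) *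
          (χ ω (ratio a / r) * ψ ω (ratio fun i => (φ i).eval (a i))) := by
      intro ω
      have := hprod id a ω ha
      simp only [id] at this
      rw [this, div_eq_mul_inv (ratio a), map_mul]
      ring
    push_cast at hcomm
    rw [Finset.sum_congr rfl fun ω _ => hcomm ω, ← Finset.mul_sum, hz]
    have hiff : ((ratio a / r, ratio fun i => (φ i).eval (a i)) : ℚ × ℚ) = 1 ↔
        (∏ i : Fin s, a (Fin.castAdd s i)) = r * (∏ i : Fin s, a (Fin.natAdd s i)) ∧
        (∏ i : Fin s, (φ (Fin.castAdd s i)).eval (a (Fin.castAdd s i))) =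
          ∏ i : Fin s, (φ (Fin.natAdd s i)).eval (a (Fin.natAdd s i)) := by
      rw [Prod.ext_iff, ← hone a (fun i => (hA _ (ha i)).1) r hr]
      have := hone (fun i => (φ i).eval (a i)) (fun i => (hA _ (ha i)).2 _) 1 one_ne_zero
      rw [div_one, one_mul] at this
      exact and_congr Iff.rfl this
    simp only [hiff]
    split_ifs <;> push_cast <;> ring
  have hcardpos : (0 : ℝ) < Fintype.card Ω := by exact_mod_cast hΩ
  have hle : (Fintype.card Ω : ℝ) * weightedRatioCount s w φ A r ≤ Y ^ s := by
    calc (Fintype.card Ω : ℝ) * weightedRatioCount s w φ A r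
        ≤ ‖((Fintype.card Ω * weightedRatioCount s w φ A r : ℝ) : ℂ)‖ := by
          rw [Complex.norm_real]; exact Real.le_norm_self _
      _ ≤ ∑ ω, ∏ i, ‖phaseSum w (e i) A ω‖ := by
          rw [hcount]
          refine (norm_sum_le _ _).trans (Finset.sum_le_sum fun ω _ => ?_)
          rw [norm_mul, hχ ω _ (inv_ne_zero hr), one_mul, norm_prod]
          simp only [norm_halfConj]
          exact le_rfl
      _ ≤ ∏ i, evenNorm s (phaseSum w (e i) A) := sum_prod_norm_le_prod_evenNorm hs _
      _ ≤ ∏ _i : Fin (s + s), √Y :=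
          Finset.prod_le_prod (fun i _ => evenNorm_nonneg hs _) fun i _ => hnorm i
      _ = Y ^ s := by
          rw [Finset.prod_const, Finset.card_univ, Fintype.card_fin, ← two_mul, pow_mul,
            Real.sq_sqrt hY0]
  have hYs : Y ^ s = Fintype.card Ω *
      (2 * (2 * ((d : ℝ) + 1) ^ 2 * (8 * s) ^ 2) ^ n * ∑ a ∈ A, w a ^ 2) ^ s := by
    rw [hY, mul_left_comm, mul_pow, evenNorm_one_sq_pow hs]
  rw [hYs] at hle
  exact le_of_mul_le_mul_left hle hcardpos

lemma weightedJ_eq_weightedRatioCount (s : ℕ) (w : ℚ → ℝ) (φ : Fin (s + s) → ℚ[X])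
    (A : Finset ℚ) : weightedJ s w φ A = weightedRatioCount s w φ A 1 := by
  simp only [weightedJ, weightedRatioCount, one_mul]

lemma weightedM_eq_sum_weightedRatioCount (s : ℕ) (w : ℚ → ℝ) (φ : Fin (s + s) → ℚ[X])
    {A R : Finset ℚ} (hA : ∀ a ∈ A, a ≠ 0)
    (hR : ∀ a : Fin (s + s) → ℚ, (∀ i, a i ∈ A) →
        (∏ i : Fin s, a (Fin.castAdd s i)) / (∏ i : Fin s, a (Fin.natAdd s i)) ∈ R) :
    weightedM s w φ A = ∑ r ∈ R, weightedRatioCount s w φ A r := by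
  simp only [weightedM, weightedRatioCount]
  rw [Finset.sum_comm]
  refine Finset.sum_congr rfl fun a ha => ?_
  rw [Fintype.mem_piFinset] at ha
  have hne : (∏ i : Fin s, a (Fin.natAdd s i)) ≠ 0 :=
    Finset.prod_ne_zero_iff.2 fun i _ => hA _ (ha _)
  rw [Finset.sum_eq_single_of_mem _ (hR a ha)]
  · simp only [div_mul_cancel₀ _ hne, true_and]
  · intro r _ hr
    rw [if_neg]
    rintro ⟨h, -⟩
    exact hr (by rw [h, mul_div_cancel_right₀ _ hne])

/-! ### The depth bound and the final exponent -/

lemma exists_not_hasPadicTree {A : Finset ℚ} {K : ℝ} (hA : ∀ a ∈ A, a ≠ 0) (hne : A.Nonempty)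
    (hK : ((A * A).card : ℝ) = K * A.card) :
    ∃ n : ℕ, (2 : ℝ) ^ n ≤ K ^ 3 ∧ ¬ HasPadicTree (n + 1) A := by
  have hpos : (0 : ℝ) < A.card := by exact_mod_cast hne.card_pos
  have h0 : (0 : ℚ) ∉ A := fun h => hA 0 h rfl
  have hbound : ∀ n, HasPadicTree n A → (2 : ℝ) ^ n ≤ K ^ 3 := by
    intro n hn
    have h := (hn.le_card_mul h0 A A hne hne h0 h0).trans (card_mul_mul_le hA hne hK)
    rw [Real.sqrt_mul_self hpos.le] at h
    exact le_of_mul_le_mul_right h hpos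
  have hex : ∃ n, ¬ HasPadicTree n A := by
    obtain ⟨n, hn⟩ := pow_unbounded_of_one_lt (K ^ 3) (one_lt_two (α := ℝ))
    exact ⟨n, fun h => absurd (hbound n h) (not_le.2 hn)⟩
  classical
  have hspec := Nat.find_spec hex
  -- The least missing depth is positive because a nonempty set has a tree of depth zero.
  obtain ⟨m, hm⟩ : ∃ m, Nat.find hex = m + 1 :=
    Nat.exists_eq_succ_of_ne_zero fun h => by rw [h] at hspec; exact hspec hne
  refine ⟨m, hbound m ?_, hm ▸ hspec⟩
  exact not_not.1 (Nat.find_min hex (m := m) (by omega))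

/-- From `2 ^ n ≤ K ^ 3` one gets `Λ ^ n ≤ K ^ (3 * logb 2 Λ)`. Since `Λ ≤ (d + 3) ^ 5 * (2 * s) ^
2`, the exponent per `s` is at most `2 + 15 * logb 2 (d + 3) + 6 * logb 2 (2 * s)`, within the
stated one. -/
lemma pow_mul_pow_le_rpow {s d n : ℕ} (hs : 1 ≤ s) (hd : 1 ≤ d) {K : ℝ} (hK : 1 ≤ K)
    (hn : (2 : ℝ) ^ n ≤ K ^ 3) :
    K ^ (2 * s) * ((2 * ((d : ℝ) + 1) ^ 2 * (8 * s) ^ 2) ^ n) ^ s ≤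
      K ^ ((10 + 48 * Real.logb 2 ((d : ℝ) + 3) + 6 * Real.logb 2 (2 * (s : ℝ))) * (s : ℝ)) := by
  have hs1 : (1 : ℝ) ≤ s := by exact_mod_cast hs
  have hd1 : (1 : ℝ) ≤ d := by exact_mod_cast hd
  have hK0 : 0 < K := by linarith
  set Λ : ℝ := 2 * ((d : ℝ) + 1) ^ 2 * (8 * s) ^ 2 with hΛ
  have hΛ0 : 0 < Λ := by positivity
  have hΛle : Λ ≤ ((d : ℝ) + 3) ^ 5 * (2 * s) ^ 2 := by
    have h1 : ((d : ℝ) + 1) ^ 2 ≤ ((d : ℝ) + 3) ^ 2 := by gcongr; norm_num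
    have h2 : (4 : ℝ) ^ 3 ≤ ((d : ℝ) + 3) ^ 3 := by gcongr; linarith
    have h3 : 32 * ((d : ℝ) + 1) ^ 2 ≤ ((d : ℝ) + 3) ^ 5 := by
      calc 32 * ((d : ℝ) + 1) ^ 2 ≤ ((d : ℝ) + 3) ^ 3 * ((d : ℝ) + 3) ^ 2 := by
            gcongr
            linarith
        _ = ((d : ℝ) + 3) ^ 5 := by ring
    calc Λ = 32 * ((d : ℝ) + 1) ^ 2 * (2 * s) ^ 2 := by rw [hΛ]; ring
      _ ≤ _ := by gcongr
  have hlogΛ : Real.logb 2 Λ ≤ 5 * Real.logb 2 ((d : ℝ) + 3) + 2 * Real.logb 2 (2 * (s : ℝ)) := by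
    refine (Real.logb_le_logb_of_le one_lt_two hΛ0 hΛle).trans (le_of_eq ?_)
    rw [Real.logb_mul (by positivity) (by positivity), Real.logb_pow, Real.logb_pow]
    norm_num
  have hlogd : 0 ≤ Real.logb 2 ((d : ℝ) + 3) := Real.logb_nonneg one_lt_two (by linarith)
  have hlogΛ0 : 0 ≤ Real.logb 2 Λ := by
    refine Real.logb_nonneg one_lt_two ?_
    have a1 : (1 : ℝ) ≤ ((d : ℝ) + 1) ^ 2 := one_le_pow₀ (by linarith)
    have a2 : (1 : ℝ) ≤ (8 * s) ^ 2 := one_le_pow₀ (by linarith)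
    nlinarith
  have hΛn : Λ ^ n ≤ K ^ (3 * Real.logb 2 Λ) := by
    calc Λ ^ n = ((2 : ℝ) ^ Real.logb 2 Λ) ^ n := by
          rw [Real.rpow_logb two_pos (by norm_num) hΛ0]
      _ = ((2 : ℝ) ^ n) ^ Real.logb 2 Λ := by
          rw [← Real.rpow_natCast, ← Real.rpow_natCast, ← Real.rpow_mul two_pos.le,
            ← Real.rpow_mul two_pos.le, mul_comm]
      _ ≤ (K ^ 3) ^ Real.logb 2 Λ := by gcongr
      _ = K ^ (3 * Real.logb 2 Λ) := by
          rw [← Real.rpow_natCast, ← Real.rpow_mul hK0.le]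
          norm_num
  calc K ^ (2 * s) * (Λ ^ n) ^ s ≤ K ^ (2 * s) * (K ^ (3 * Real.logb 2 Λ)) ^ s := by gcongr
    _ = K ^ ((2 + 3 * Real.logb 2 Λ) * s) := by
        rw [pow_mul, ← mul_pow, ← Real.rpow_natCast K 2, ← Real.rpow_add hK0,
          ← Real.rpow_natCast (K ^ _) s, ← Real.rpow_mul hK0.le]
        norm_num
    _ ≤ _ := by
        refine Real.rpow_le_rpow_of_exponent_le hK ?_
        refine mul_le_mul_of_nonneg_right ?_ (by linarith)
        linarith

theorem theorem2p1 (d s : ℕ) (hd : 1 ≤ d) (hs : 1 ≤ s) :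
    ∃ c : ℝ, 0 < c ∧
      ∀ (K : ℝ) (φ : Fin (s + s) → ℚ[X]) (A : Finset ℚ) (𝔞 : ℚ → ℝ),
        1 ≤ K →
        (∀ i, 1 ≤ (φ i).natDegree ∧ (φ i).natDegree ≤ d) →
        (∀ i, (φ i).eval 0 ≠ 0) →
        2 ≤ A.card →
        (∀ a ∈ A, a ≠ 0 ∧ ∀ i, (φ i).eval a ≠ 0) →
        ((A * A).card : ℝ) = K * (A.card : ℝ) →
        (∀ x, 0 ≤ 𝔞 x) →
        max (weightedJ s 𝔞 φ A) (weightedM s 𝔞 φ A / (A.card : ℝ)) ≤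
          c * K ^ ((10 + 48 * Real.logb 2 ((d : ℝ) + 3) + 6 * Real.logb 2 (2 * (s : ℝ))) * (s : ℝ)) *
            Real.logb 2 (A.card : ℝ) ^ (2 * s) * (∑ a ∈ A, 𝔞 a ^ 2) ^ s := by
  have hs1 : (1 : ℝ) ≤ s := by exact_mod_cast hs
  set Λ : ℝ := 2 * ((d : ℝ) + 1) ^ 2 * (8 * s) ^ 2 with hΛ
  have hΛ0 : 0 < Λ := by positivity
  -- The missing tree has depth `n + 1` while only `2 ^ n` is bounded, so one `Λ` goes into the
  -- constant; the `2` comes from sets `{b, -b}` that no prime separates.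
  refine ⟨(2 * Λ) ^ s, by positivity, ?_⟩
  intro K φ A 𝔞 hK hdeg h0 hcard hA hAA _
  have hne : A.Nonempty := Finset.card_pos.1 (by omega)
  have hA0 : ∀ a ∈ A, a ≠ 0 := fun a ha => (hA a ha).1
  have hcpos : (0 : ℝ) < A.card := by exact_mod_cast hne.card_pos
  obtain ⟨n, hn, htree⟩ := exists_not_hasPadicTree hA0 hne hAA
  obtain ⟨R, hRcard, hR0, hR⟩ := exists_ratio_finset s hA0 hne hAA
  set E : ℝ := ∑ a ∈ A, 𝔞 a ^ 2 with hE
  have hE0 : 0 ≤ E := by positivity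
  set X : ℝ := (2 * Λ ^ (n + 1) * E) ^ s with hX
  have hX0 : 0 ≤ X := by positivity
  have hr : ∀ r, r ≠ 0 → weightedRatioCount s 𝔞 φ A r ≤ X := fun r hr =>
    weightedRatioCount_le hs hdeg h0 hA htree hr
  have hJ : weightedJ s 𝔞 φ A ≤ K ^ (2 * s) * X := by
    rw [weightedJ_eq_weightedRatioCount]
    exact (hr 1 one_ne_zero).trans (le_mul_of_one_le_left hX0 (one_le_pow₀ hK))
  have hM : weightedM s 𝔞 φ A / A.card ≤ K ^ (2 * s) * X := by
    rw [div_le_iff₀ hcpos, weightedM_eq_sum_weightedRatioCount s 𝔞 φ hA0 hR]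
    calc ∑ r ∈ R, weightedRatioCount s 𝔞 φ A r ≤ ∑ _r ∈ R, X :=
          Finset.sum_le_sum fun r hrR => hr r (hR0 r hrR)
      _ = R.card * X := by rw [Finset.sum_const, nsmul_eq_mul]
      _ ≤ K ^ (2 * s) * A.card * X := by gcongr
      _ = _ := by ring
  -- The argument produces no logarithm; since `|A| ≥ 2` the logarithmic factor is at least one and
  -- only weakens the bound.
  have hlog : (1 : ℝ) ≤ Real.logb 2 (A.card : ℝ) ^ (2 * s) := by
    refine one_le_pow₀ ?_
    rw [Real.le_logb_iff_rpow_le one_lt_two hcpos, Real.rpow_one]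
    exact_mod_cast hcard
  refine (max_le hJ hM).trans ?_
  set P := K ^ ((10 + 48 * Real.logb 2 ((d : ℝ) + 3) + 6 * Real.logb 2 (2 * (s : ℝ))) * (s : ℝ))
    with hP
  have hP0 : 0 ≤ P := by positivity
  calc K ^ (2 * s) * X = (2 * Λ) ^ s * (K ^ (2 * s) * (Λ ^ n) ^ s) * E ^ s := by
        rw [hX, pow_succ]
        simp only [mul_pow]
        ring
    _ ≤ (2 * Λ) ^ s * P * E ^ s := by
        gcongr
        exact pow_mul_pow_le_rpow hs hd hK hn
    _ ≤ (2 * Λ) ^ s * P * Real.logb 2 (A.card : ℝ) ^ (2 * s) * E ^ s := by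
        refine mul_le_mul_of_nonneg_right ?_ (by positivity)
        exact le_mul_of_one_le_right (by positivity) hlog
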